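/- Let $\mathcal H,\mathcal K$ be finite-dimensional complex Hilbert spaces, and let $\mathcal A\subseteq B(\mathcal H)$, $\mathcal B\subseteq B(\mathcal K)$ be $C^*$-subalgebras containing the identity operators. Both carry the trace $\mathrm{Tr}$ of the underlying Hilbert space and the Hilbert–Schmidt inner product $\langle a,b\rangle=\mathrm{Tr}\,a^*b$; a state (density operator) of $\mathcal A$ is a positive element of trace $1$. For a linear map $T:\mathcal A\to\mathcal B$ let $T^*:\mathcal B\to\mathcal A$ be its adjoint for these inner products. A linear map $\Phi$ is a unital Schwarz map if $\Phi(I)=I$ and $\Phi(a^*a)\ge\Phi(a)^*\Phi(a)$ for all $a$. Let $\rho\in\mathcal A$ be an invertible density operator, let $x\in\mathcal A$ be self-adjoint with $\mathrm{Tr}\,x=0$, and let $T:\mathcal A\to\mathcal B$ be a linear map such that $T(\rho)$ is invertible and both $T^*$ and $$T_\rho(b)=T(\rho)^{-1/2}\,T(\rho^{1/2}b\rho^{1/2})\,T(\rho)^{-1/2}\qquad(b\in\mathcal A)$$ are unital Schwarz maps. Let $I_{\rho,x}$ be the largest interval of real $u$ containing $0$ for which $\rho+ux$ is a state, and let $\mathcal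 S_{\rho,x}=\{\rho+ux:\ u\in I_{\rho,x}\}$. We say that $T$ is reversible for a set $\mathcal S$ of states if there is a linear map $S:\mathcal B\to\mathcal A$ such that $S^*$ is a unital Schwarz map and $S(T(\sigma))=\sigma$ for all $\sigma\in\mathcal S$. For an operator monotone function $f:(0,\infty)\to(0,\infty)$ with $f(t)=t\,f(t^{-1})$ for all $t>0$, the monotone metric $\lambda^f$ is given by $$\lambda^f_\rho(x,y)=\mathrm{Tr}\,(J^f_\rho)^{-1}(x)\,y,\qquad J^f_\rho=f(\Delta_\rho)R_\rho,\qquad \Delta_\rho(a)=\rho a\rho^{-1},\qquad R_\rho(a)=a\rho\qquad(a\in\mathcal A),$$ and similarly at $T(\rho)$, with operators acting on $\mathcal B$. Let $\nu_f$ denote the positive Borel measure on $[0,\infty)$ with $\int(1+s^2)^{-1}d\nu_f(s)<\infty$ and $\int s(1+s^2)^{-1}d\nu_f(s)<\infty$ such that, for some constant $c\ge0$, $$f(t)^{-1}=c+\int_{[0,\infty)}\frac{1}{s+t}\,d\nu_f(s),\qquad t>0 .$$ Then the following are equivalent. 1. There is a monotone metric $\lambda^f$ with $|\mathrm{supp}\,\nu_f|\ge|\mathrm{spec}(\Delta_\rho)\cup\mathrm{spec}(\Delta_{T(\rho)})|$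 such that $\lambda^f_\rho(x,x)=\lambda^f_{T(\rho)}(T(x),T(x))$. 2. $\rho^{it}x\rho^{-it-1}=T^*\big(T(\rho)^{it}\,T(x)\,T(\rho)^{-it-1}\big)$ for all $t\in\mathbb R$. 3. $\rho^{-1/2}x\rho^{-1/2}=T^*\big(T(\rho)^{-1/2}\,T(x)\,T(\rho)^{-1/2}\big)$. 4. $T$ is reversible for $\mathcal S_{\rho,x}$. 5. $\lambda^f_\rho(x,x)=\lambda^f_{T(\rho)}(T(x),T(x))$ for every monotone metric $\lambda^f$. -/

import Mathlib

open MeasureTheory Set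

noncomputable section

namespace QRev

variable {H K : Type*}
  [NormedAddCommGroup H] [InnerProductSpace ℂ H] [CompleteSpace H] [FiniteDimensional ℂ H]
  [NormedAddCommGroup K] [InnerProductSpace ℂ K] [CompleteSpace K] [FiniteDimensional ℂ K]

/-! A finite-dimensional C*-algebra `𝒜 ⊆ B(H)` is a (unital) `StarSubalgebra ℂ (H →L[ℂ] H)`. -/

/-- In finite dimension every star subalgebra is norm closed; by Mathlib's
`StarSubalgebra.cstarAlgebra` it is then a C*-algebra, with continuous functional calculus. -/
instance isClosed_coe (A : StarSubalgebra ℂ (H →L[ℂ] H)) :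
    IsClosed (A : Set (H →L[ℂ] H)) :=
  Submodule.closed_of_finiteDimensional (Subalgebra.toSubmodule A.toSubalgebra)

instance finiteDimensional_coe (A : StarSubalgebra ℂ (H →L[ℂ] H)) :
    FiniteDimensional ℂ A :=
  FiniteDimensional.finiteDimensional_submodule (Subalgebra.toSubmodule A.toSubalgebra)

/-- The trace `Tr = Tr_H` on `𝒜 ⊆ B(H)`. -/
def Tr {A : StarSubalgebra ℂ (H →L[ℂ] H)} : A →ₗ[ℂ] ℂ where
  toFun a := LinearMap.trace ℂ H ((a : H →L[ℂ] H) : H →ₗ[ℂ] H)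
  map_add' a b := by simp
  map_smul' c a := by simp

/-- The density operators (states) of `𝒜`: positive elements of unit trace. -/
def IsDensity {A : StarSubalgebra ℂ (H →L[ℂ] H)} (σ : A) : Prop :=
  0 ≤ (σ : H →L[ℂ] H) ∧ Tr σ = 1

theorem trace_star_mul_self {A : StarSubalgebra ℂ (H →L[ℂ] H)} (a : A) :
    Tr (star a * a) =
      ((∑ i, ‖(a : H →L[ℂ] H) (stdOrthonormalBasis ℂ H i)‖ ^ 2 : ℝ) : ℂ) := by
  have h := LinearMap.trace_eq_sum_inner
    (((star a * a : A) : H →L[ℂ] H) : H →ₗ[ℂ] H) (stdOrthonormalBasis ℂ H)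
  refine h.trans ?_
  rw [Complex.ofReal_sum]
  refine Finset.sum_congr rfl fun i _ => ?_
  have : (((star a * a : A) : H →L[ℂ] H) : H →ₗ[ℂ] H) (stdOrthonormalBasis ℂ H i)
      = ContinuousLinearMap.adjoint (a : H →L[ℂ] H)
          ((a : H →L[ℂ] H) (stdOrthonormalBasis ℂ H i)) := rfl
  rw [this, ContinuousLinearMap.adjoint_inner_right, inner_self_eq_norm_sq_to_K]
  norm_cast

theorem Tr_star {A : StarSubalgebra ℂ (H →L[ℂ] H)} (a : A) :
    Tr (star a) = starRingEnd ℂ (Tr a) := by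
  have h1 := LinearMap.trace_eq_sum_inner
    (((star a : A) : H →L[ℂ] H) : H →ₗ[ℂ] H) (stdOrthonormalBasis ℂ H)
  have h2 := LinearMap.trace_eq_sum_inner
    ((a : H →L[ℂ] H) : H →ₗ[ℂ] H) (stdOrthonormalBasis ℂ H)
  refine h1.trans ?_
  rw [show (Tr a : ℂ) = _ from h2, map_sum]
  refine Finset.sum_congr rfl fun i _ => ?_
  have : (((star a : A) : H →L[ℂ] H) : H →ₗ[ℂ] H) (stdOrthonormalBasis ℂ H i)
      = ContinuousLinearMap.adjoint (a : H →L[ℂ] H) (stdOrthonormalBasis ℂ H i) := rfl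
  rw [this, ContinuousLinearMap.adjoint_inner_right, inner_conj_symm]
  rfl

/-- The Hilbert-Schmidt inner product `⟨a, b⟩ = Tr a* b` on `𝒜`. -/
abbrev hsCore (A : StarSubalgebra ℂ (H →L[ℂ] H)) : InnerProductSpace.Core ℂ A where
  inner a b := Tr (star a * b)
  conj_inner_symm a b := by rw [← Tr_star, star_mul, star_star]
  re_inner_nonneg a := by
    rw [trace_star_mul_self]
    rw [RCLike.re_eq_complex_re, Complex.ofReal_re]
    exact Finset.sum_nonneg fun i _ => sq_nonneg _
  add_left a b c := by rw [star_add, add_mul, map_add]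
  smul_left a b c := by rw [star_smul, smul_mul_assoc, map_smul, smul_eq_mul]; rfl
  definite a h := by
    rw [trace_star_mul_self, Complex.ofReal_eq_zero,
      Finset.sum_eq_zero_iff_of_nonneg fun i _ => by positivity] at h
    apply Subtype.ext
    apply ContinuousLinearMap.coe_injective
    refine (stdOrthonormalBasis ℂ H).toBasis.ext fun i => ?_
    simpa using h i (Finset.mem_univ i)

/-- The adjoint `T* : ℬ → 𝒜` of a linear map `T : 𝒜 → ℬ` with respect to the
Hilbert-Schmidt inner products. -/
def hsAdjoint {A : StarSubalgebra ℂ (H →L[ℂ] H)} {B : StarSubalgebra ℂ (K →L[ℂ] K)}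
    (T : A →ₗ[ℂ] B) : B →ₗ[ℂ] A :=
  @LinearMap.adjoint ℂ A B _
    (hsCore A).toNormedAddCommGroup (hsCore B).toNormedAddCommGroup
    (InnerProductSpace.ofCore (hsCore A).toCore) (InnerProductSpace.ofCore (hsCore B).toCore)
    (finiteDimensional_coe A) (finiteDimensional_coe B) T

/-- The defining property `⟨T*(b), a⟩ = ⟨b, T(a)⟩` of the Hilbert-Schmidt adjoint. -/
theorem Tr_hsAdjoint {A : StarSubalgebra ℂ (H →L[ℂ] H)} {B : StarSubalgebra ℂ (K →L[ℂ] K)}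
    (T : A →ₗ[ℂ] B) (a : A) (b : B) :
    Tr (star (hsAdjoint T b) * a) = Tr (star b * T a) :=
  @LinearMap.adjoint_inner_left ℂ A B _
    (hsCore A).toNormedAddCommGroup (hsCore B).toNormedAddCommGroup
    (InnerProductSpace.ofCore (hsCore A).toCore) (InnerProductSpace.ofCore (hsCore B).toCore)
    (finiteDimensional_coe A) (finiteDimensional_coe B) T a b

/-- Unital Schwarz maps: `Φ(I) = I` and `Φ(a* a) ≥ Φ(a)* Φ(a)`. -/
def IsUnitalSchwarz {A : StarSubalgebra ℂ (H →L[ℂ] H)} {B : StarSubalgebra ℂ (K →L[ℂ] K)}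
    (Φ : A →ₗ[ℂ] B) : Prop :=
  Φ 1 = 1 ∧
    ∀ a : A, ((star (Φ a) * Φ a : B) : K →L[ℂ] K) ≤ ((Φ (star a * a) : B) : K →L[ℂ] K)

/-- The complex power `ρ ^ z`, by the continuous functional calculus of the C*-algebra `𝒜`
(used for positive invertible `ρ`). -/
def cpower {A : StarSubalgebra ℂ (H →L[ℂ] H)} (ρ : A) (z : ℂ) : A :=
  cfc (fun w : ℂ => w ^ z) ρ

/-- `T_ρ(b) = T(ρ)^{-1/2} T(ρ^{1/2} b ρ^{1/2}) T(ρ)^{-1/2}`, for `ρ` and `T(ρ)` invertible. -/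
def dualMap {A : StarSubalgebra ℂ (H →L[ℂ] H)} {B : StarSubalgebra ℂ (K →L[ℂ] K)}
    (T : A →ₗ[ℂ] B) (ρ : A) : A →ₗ[ℂ] B :=
  LinearMap.mulLeftRight ℂ (cpower (T ρ) (-1 / 2), cpower (T ρ) (-1 / 2)) ∘ₗ T ∘ₗ
    LinearMap.mulLeftRight ℂ (cpower ρ (1 / 2), cpower ρ (1 / 2))

/-- `T` is reversible for the set `𝒮`: there is a map `S : ℬ → 𝒜` such that `S*` is a unital
Schwarz map and `S(T(σ)) = σ` for all `σ ∈ 𝒮`. -/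
def IsReversible {A : StarSubalgebra ℂ (H →L[ℂ] H)} {B : StarSubalgebra ℂ (K →L[ℂ] K)}
    (T : A →ₗ[ℂ] B) (𝒮 : Set A) : Prop :=
  ∃ S : B →ₗ[ℂ] A, IsUnitalSchwarz (hsAdjoint S) ∧ ∀ σ ∈ 𝒮, S (T σ) = σ

/-- The parameters `u ∈ ℝ` for which `ρ + u x` is a state. As the set of states is convex, this
set is an interval (`ordConnected_stateInterval`), hence it is the largest interval `I` such that
`ρ + u x` is a state for all `u ∈ I`. -/
def stateInterval {A : StarSubalgebra ℂ (H →L[ℂ] H)} (ρ x : A) : Set ℝ :=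
  {u : ℝ | IsDensity (ρ + (u : ℂ) • x)}

theorem ordConnected_stateInterval {A : StarSubalgebra ℂ (H →L[ℂ] H)} (ρ x : A) :
    (stateInterval ρ x).OrdConnected := by
  rw [← convex_iff_ordConnected]
  intro u hu v hv a b ha hb hab
  have hab' : (a : ℂ) + b = 1 := by exact_mod_cast hab
  have key : ρ + ((a • u + b • v : ℝ) : ℂ) • x
      = (a : ℂ) • (ρ + (u : ℂ) • x) + (b : ℂ) • (ρ + (v : ℂ) • x) := by
    have : ρ = ((a : ℂ) + b) • ρ := by rw [hab', one_smul]
    nth_rewrite 1 [this]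
    simp only [smul_eq_mul, Complex.ofReal_add, Complex.ofReal_mul]
    module
  change IsDensity _
  rw [key]
  refine ⟨?_, ?_⟩
  · have h1 : 0 ≤ a • ((ρ + (u : ℂ) • x : A) : H →L[ℂ] H) := smul_nonneg ha hu.1
    have h2 : 0 ≤ b • ((ρ + (v : ℂ) • x : A) : H →L[ℂ] H) := smul_nonneg hb hv.1
    exact add_nonneg h1 h2
  · rw [map_add, map_smul, map_smul, hu.2, hv.2]
    simpa using hab'

/-- The maximal line segment of states `𝒮_{ρ,x} = {ρ + u x : u ∈ I_{ρ,x}}`. -/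
def stateSegment {A : StarSubalgebra ℂ (H →L[ℂ] H)} (ρ x : A) : Set A :=
  (fun u : ℝ => ρ + (u : ℂ) • x) '' stateInterval ρ x

/-- The modular operator `Δ_ρ = L_ρ R_ρ⁻¹`, that is `a ↦ ρ a ρ⁻¹`, acting on `𝒜`
(for invertible `ρ`). -/
def modularOp {A : StarSubalgebra ℂ (H →L[ℂ] H)} (ρ : A) : Module.End ℂ A :=
  LinearMap.mulLeft ℂ ρ * LinearMap.mulRight ℂ (Ring.inverse ρ)

/-- `f(D)` for a diagonalizable operator `D` with real spectrum on a finite-dimensional space: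
`p(D)`, where `p` is the polynomial interpolating `f` on the spectrum of `D`. -/
def opFun {V : Type*} [AddCommGroup V] [Module ℂ V] [FiniteDimensional ℂ V]
    (f : ℝ → ℝ) (D : Module.End ℂ V) : Module.End ℂ V :=
  Polynomial.aeval D (Lagrange.interpolate (Module.End.finite_spectrum D).toFinset id
    (fun z : ℂ => ((f z.re : ℝ) : ℂ)))

/-- `f(D)` acts on an eigenvector of `D` with eigenvalue `t` as multiplication by `f(t)`. -/
theorem opFun_apply_of_eigenvector {V : Type*} [AddCommGroup V] [Module ℂ V]
    [FiniteDimensional ℂ V] (f : ℝ → ℝ) (D : Module.End ℂ V) (t : ℝ) (v : V)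
    (h : Module.End.HasEigenvector D (t : ℂ) v) :
    opFun f D v = ((f t : ℝ) : ℂ) • v := by
  have ht : (t : ℂ) ∈ (Module.End.finite_spectrum D).toFinset := by
    rw [Set.Finite.mem_toFinset]
    exact (Module.End.hasEigenvalue_of_hasEigenvector h).mem_spectrum
  have he := Lagrange.eval_interpolate_at_node (v := (id : ℂ → ℂ))
    (fun z : ℂ => ((f z.re : ℝ) : ℂ)) Function.injective_id.injOn ht
  rw [opFun, Module.End.aeval_apply_of_hasEigenvector h]
  simp only [id, Complex.ofReal_re] at he
  rw [← he]

/-- `J^f_ρ = f(Δ_ρ) R_ρ`. -/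
def JOp {A : StarSubalgebra ℂ (H →L[ℂ] H)} (f : ℝ → ℝ) (ρ : A) : Module.End ℂ A :=
  opFun f (modularOp ρ) * LinearMap.mulRight ℂ ρ

/-- `λ^f_ρ(x, y) = Tr (J^f_ρ)⁻¹(x) y`. -/
def monotoneMetric {A : StarSubalgebra ℂ (H →L[ℂ] H)} (f : ℝ → ℝ) (ρ x y : A) : ℂ :=
  Tr (Ring.inverse (JOp f ρ) x * y)

/-- `f : (0,∞) → (0,∞)` is operator monotone: `f(X) ≤ f(Y)` for all positive invertible matrices
`X ≤ Y` of any size. (Values of `f` outside `(0,∞)` play no role.) -/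
def IsOperatorMonotone (f : ℝ → ℝ) : Prop :=
  (∀ t : ℝ, 0 < t → 0 < f t) ∧
    ∀ (n : ℕ) (X Y : EuclideanSpace ℂ (Fin n) →L[ℂ] EuclideanSpace ℂ (Fin n)),
      0 ≤ X → IsUnit X → X ≤ Y → cfc f X ≤ cfc f Y

/-- The functions `f` defining monotone metrics `λ^f`: operator monotone `f : (0,∞) → (0,∞)`
with the symmetry `f(t) = t f(t⁻¹)`. -/
def IsMetricFunction (f : ℝ → ℝ) : Prop :=
  IsOperatorMonotone f ∧ ∀ t : ℝ, 0 < t → f t = t * f t⁻¹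

/-- `ν` is the measure `ν_f` of the integral representation of `1/f`: a positive Borel measure
on `[0,∞)` with `∫ (1+s²)⁻¹ dν < ∞`, `∫ s (1+s²)⁻¹ dν < ∞` and
`f(t)⁻¹ = c + ∫ (s+t)⁻¹ dν(s)` for all `t > 0`, with a constant `c ≥ 0`. -/
def IsRepresentingMeasure (f : ℝ → ℝ) (ν : Measure ℝ) : Prop :=
  ν (Iio 0) = 0 ∧
    Integrable (fun s : ℝ => (1 + s ^ 2)⁻¹) ν ∧
    Integrable (fun s : ℝ => s * (1 + s ^ 2)⁻¹) ν ∧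
    ∃ c : ℝ, 0 ≤ c ∧ ∀ t : ℝ, 0 < t → (f t)⁻¹ = c + ∫ s, (s + t)⁻¹ ∂ν

end QRev

end

/-! Every condition except reversibility concerns the elements `g(Δ_ρ)(xρ⁻¹)`, written `modFun ρ g
x`: `g(t) = t^{iu}` in 2, `t^{-1/2}` in 3, `1/f(t)` in the metrics. Consider the identity E(g):
`g(Δ_ρ)(xρ⁻¹) = T*(g(Δ_{T(ρ)})(T(x)T(ρ)⁻¹))`. It is linear in `g` and depends only on `g` on a
finite set, the union of the two modular spectra. So a family of `g` that spans the functions on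
that set yields E(g) for all `g`.

The analytic core is `quad_resolv_gap`, for `g(t) = (α + βt)⁻¹`: the Schwarz inequality and a
completed square show that the quadratic form of `g` cannot increase under `T`, and that no decrease
forces E(g).

1 → 2: equality of metrics is the vanishing of the `ν_f`-integral of nonnegative gaps, so E holds
for `(s + t)⁻¹` at each `s` in the support; with enough points `s` these functions span
(`exists_resolv_combination`). 2 → 3: imaginary powers span too
(`exists_imaginary_power_combination`). 3 → 4: the recovery map is the Petz dual, whose adjoint is
`T_ρ`. 4 → 5: monotonicity under `T` and under the recovery map closes every resolvent gap, hence
E(g) for all `g`; pairing E(1/f) with `x` gives equality of metrics. 5 → 1: `f = √t` has a measure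
with support containing `[0,∞)`. -/

open MeasureTheory Set

noncomputable section

namespace QRev

variable {H K : Type*}
  [NormedAddCommGroup H] [InnerProductSpace ℂ H] [CompleteSpace H] [FiniteDimensional ℂ H]
  [NormedAddCommGroup K] [InnerProductSpace ℂ K] [CompleteSpace K] [FiniteDimensional ℂ K]

/-! ### Spectral projections and Schur multipliers -/

section SpectralProjections

/-- Left multiplication embeds the algebra in its endomorphisms, whose spectra are finite. If left
multiplication by an element is bijective, surjectivity gives a right inverse and injectivity makes
it two-sided. -/
theorem finite_spectrum {R : Type*} [Ring R] [Algebra ℂ R] [FiniteDimensional ℂ R] (a : R) :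
    (spectrum ℂ a).Finite := by
  refine (Module.End.finite_spectrum (Algebra.lmul ℂ R a)).subset fun z hz hz' => hz ?_
  change IsUnit _ at hz'
  change IsUnit _
  rw [← AlgHom.commutes (Algebra.lmul ℂ R) z, ← map_sub] at hz'
  have hs := (Module.End.isUnit_iff _).1 hz'
  obtain ⟨b, hb⟩ := hs.2 1
  have hb : (algebraMap ℂ R z - a) * b = 1 := hb
  have hb' : b * (algebraMap ℂ R z - a) = 1 := by
    apply hs.1
    change (algebraMap ℂ R z - a) * (b * (algebraMap ℂ R z - a)) = (algebraMap ℂ R z - a) * 1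
    rw [← mul_assoc, hb, one_mul, mul_one]
  exact ⟨⟨_, b, hb, hb'⟩, rfl⟩

variable {A : StarSubalgebra ℂ (H →L[ℂ] H)}

/-- The spectrum of an element of a finite-dimensional algebra, as a `Finset`. -/
def spec (ρ : A) : Finset ℂ := (finite_spectrum ρ).toFinset

theorem mem_spec {ρ : A} {z : ℂ} : z ∈ spec ρ ↔ z ∈ spectrum ℂ ρ := by simp [spec]

/-- This makes the functional calculus available for arbitrary functions, in particular indicators
of points. -/
theorem continuousOn_spectrum (ρ : A) (f : ℂ → ℂ) : ContinuousOn f (spectrum ℂ ρ) :=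
  (finite_spectrum ρ).continuousOn f

/-- The spectral projection of `ρ` for the eigenvalue `z`. -/
def sproj (ρ : A) (z : ℂ) : A := cfc (fun w : ℂ => if w = z then 1 else 0) ρ

theorem cfc_eq_sum_sproj (ρ : A) [IsStarNormal ρ] (f : ℂ → ℂ) :
    cfc f ρ = ∑ z ∈ spec ρ, f z • sproj ρ z := by
  have h : cfc f ρ = cfc (∑ z ∈ spec ρ, fun w => f z • (if w = z then (1 : ℂ) else 0)) ρ := by
    refine cfc_congr fun w hw => ?_
    rw [Finset.sum_apply, Finset.sum_eq_single w]
    · simp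
    · intro b _ hb; simp [hb.symm]
    · intro h; exact absurd (mem_spec.2 hw) h
  rw [h, cfc_sum _ ρ _ fun _ _ => continuousOn_spectrum _ _]
  exact Finset.sum_congr rfl fun z _ => cfc_smul _ _ _ (continuousOn_spectrum _ _)

theorem star_sproj (ρ : A) {z : ℂ} : star (sproj ρ z) = sproj ρ z := by
  rw [sproj, ← cfc_star]
  congr 1
  ext w
  split_ifs <;> simp

theorem sproj_mul_sproj (ρ : A) (z w : ℂ) :
    sproj ρ z * sproj ρ w = if z = w then sproj ρ z else 0 := by
  rw [sproj, sproj, ← cfc_mul _ _ _ (continuousOn_spectrum _ _) (continuousOn_spectrum _ _)]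
  split_ifs with h
  · subst h; congr 1; ext v; split_ifs <;> simp
  · rw [← cfc_zero ℂ ρ]
    congr 1; ext v
    by_cases hv : v = z
    · simp [hv, h]
    · simp [hv]

theorem sum_smul_sproj (ρ : A) [IsStarNormal ρ] : ∑ z ∈ spec ρ, z • sproj ρ z = ρ := by
  have := cfc_eq_sum_sproj ρ id
  rw [cfc_id ℂ ρ] at this
  simpa using this.symm

theorem sproj_ne_zero (ρ : A) [IsStarNormal ρ] {z : ℂ} (hz : z ∈ spec ρ) : sproj ρ z ≠ 0 := by
  intro h
  rw [sproj, ← cfc_zero ℂ ρ, cfc_eq_cfc_iff_eqOn (R := ℂ) (hf := continuousOn_spectrum _ _)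
    (hg := continuousOn_spectrum _ _)] at h
  simpa using h (mem_spec.1 hz)

theorem mul_sproj (ρ : A) [IsStarNormal ρ] {z : ℂ} (hz : z ∈ spec ρ) :
    ρ * sproj ρ z = z • sproj ρ z := by
  nth_rewrite 1 [← sum_smul_sproj ρ]
  simp [Finset.sum_mul, sproj_mul_sproj, hz]

theorem sproj_mul (ρ : A) [IsStarNormal ρ] {z : ℂ} (hz : z ∈ spec ρ) :
    sproj ρ z * ρ = z • sproj ρ z := by
  nth_rewrite 2 [← sum_smul_sproj ρ]
  simp [Finset.mul_sum, sproj_mul_sproj, hz]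

/-- The Schur multiplier `a ↦ ∑ k(z, w) p_z a p_w` over the spectral projections of `ρ`: the joint
functional calculus of left and right multiplication by `ρ`. -/
def schur (ρ : A) (k : ℂ → ℂ → ℂ) : A →ₗ[ℂ] A :=
  ∑ z ∈ spec ρ, ∑ w ∈ spec ρ, k z w • LinearMap.mulLeftRight ℂ (sproj ρ z, sproj ρ w)

theorem schur_apply (ρ : A) (k : ℂ → ℂ → ℂ) (a : A) :
    schur ρ k a = ∑ z ∈ spec ρ, ∑ w ∈ spec ρ, k z w • (sproj ρ z * a * sproj ρ w) := by
  simp [schur]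

/-- Restricting to nonzero blocks matters: exactly for these is `z / w` guaranteed to be an
eigenvalue of `Δ_ρ` on the algebra. -/
theorem schur_congr {ρ : A} {k l : ℂ → ℂ → ℂ} {a : A}
    (h : ∀ z ∈ spec ρ, ∀ w ∈ spec ρ, sproj ρ z * a * sproj ρ w ≠ 0 → k z w = l z w) :
    schur ρ k a = schur ρ l a := by
  rw [schur_apply, schur_apply]
  refine Finset.sum_congr rfl fun z hz => Finset.sum_congr rfl fun w hw => ?_
  by_cases h0 : sproj ρ z * a * sproj ρ w = 0
  · simp [h0]
  · rw [h z hz w hw h0]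

theorem sproj_mul_schur_mul_sproj (ρ : A) (k : ℂ → ℂ → ℂ) (a : A) {z w : ℂ}
    (hz : z ∈ spec ρ) (hw : w ∈ spec ρ) :
    sproj ρ z * schur ρ k a * sproj ρ w = k z w • (sproj ρ z * a * sproj ρ w) := by
  rw [schur_apply, Finset.mul_sum, Finset.sum_mul, Finset.sum_eq_single z, Finset.mul_sum,
    Finset.sum_mul, Finset.sum_eq_single w]
  · rw [mul_smul_comm, smul_mul_assoc, ← mul_assoc, ← mul_assoc, sproj_mul_sproj, if_pos rfl,
      mul_assoc (_ * a), sproj_mul_sproj, if_pos rfl]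
  · intro v _ hv
    rw [mul_smul_comm, smul_mul_assoc, mul_assoc, mul_assoc _ (sproj ρ v), sproj_mul_sproj,
      if_neg hv]
    simp
  · exact fun h => absurd hw h
  · intro v _ hv
    rw [Finset.mul_sum, Finset.sum_mul]
    refine Finset.sum_eq_zero fun u _ => ?_
    rw [mul_smul_comm, ← mul_assoc, ← mul_assoc, sproj_mul_sproj, if_neg hv.symm]
    simp
  · exact fun h => absurd hz h

theorem schur_schur (ρ : A) (k l : ℂ → ℂ → ℂ) (a : A) :
    schur ρ k (schur ρ l a) = schur ρ (fun z w => k z w * l z w) a := by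
  rw [schur_apply, schur_apply ρ (fun z w => k z w * l z w)]
  refine Finset.sum_congr rfl fun z hz => Finset.sum_congr rfl fun w hw => ?_
  rw [sproj_mul_schur_mul_sproj ρ l a hz hw, smul_smul]

theorem schur_sum {ι : Type*} (s : Finset ι) (ρ : A) (c : ι → ℂ) (k : ι → ℂ → ℂ → ℂ) (a : A) :
    schur ρ (fun z w => ∑ i ∈ s, c i * k i z w) a = ∑ i ∈ s, c i • schur ρ (k i) a := by
  simp only [schur_apply, Finset.smul_sum, Finset.sum_smul, mul_smul]
  rw [Finset.sum_comm (s := s)]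
  refine Finset.sum_congr rfl fun z _ => ?_
  rw [Finset.sum_comm]

theorem cfc_mul_mul_cfc (ρ : A) [IsStarNormal ρ] (f g : ℂ → ℂ) (a : A) :
    cfc f ρ * a * cfc g ρ = schur ρ (fun z w => f z * g w) a := by
  simp only [cfc_eq_sum_sproj ρ, schur_apply, Finset.sum_mul, Finset.mul_sum, smul_mul_assoc,
    mul_smul_comm, Finset.smul_sum]
  rw [Finset.sum_comm]
  simp only [smul_smul, mul_comm]

theorem schur_one (ρ : A) [IsStarNormal ρ] (a : A) : schur ρ (fun _ _ => 1) a = a := by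
  have := cfc_mul_mul_cfc ρ (fun _ => 1) (fun _ => 1) a
  rw [cfc_const_one ℂ ρ] at this
  simpa using this.symm

theorem schur_fst (ρ : A) [IsStarNormal ρ] (a : A) : schur ρ (fun z _ => z) a = ρ * a := by
  have := cfc_mul_mul_cfc ρ (fun z => z) (fun _ => 1) a
  rw [cfc_const_one ℂ ρ, cfc_id' ℂ ρ] at this
  simpa using this.symm

theorem schur_snd (ρ : A) [IsStarNormal ρ] (a : A) : schur ρ (fun _ w => w) a = a * ρ := by
  have := cfc_mul_mul_cfc ρ (fun _ => 1) (fun z => z) a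
  rw [cfc_const_one ℂ ρ, cfc_id' ℂ ρ] at this
  simpa using this.symm

end SpectralProjections

/-! ### Trace duality, Schwarz maps and positivity -/

section Trace

variable {A : StarSubalgebra ℂ (H →L[ℂ] H)} {B : StarSubalgebra ℂ (K →L[ℂ] K)}

theorem Tr_mul_comm (a b : A) : Tr (a * b) = Tr (b * a) :=
  LinearMap.trace_mul_comm ℂ ((a : H →L[ℂ] H) : H →ₗ[ℂ] H) ((b : H →L[ℂ] H) : H →ₗ[ℂ] H)

theorem re_Tr_star_mul_self_nonneg (a : A) : 0 ≤ (Tr (star a * a)).re := by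
  rw [trace_star_mul_self, Complex.ofReal_re]
  positivity

theorem eq_zero_of_re_Tr_star_mul_self {a : A} (h : (Tr (star a * a)).re ≤ 0) : a = 0 := by
  have h0 : Tr (star a * a) = 0 := by
    have h1 := re_Tr_star_mul_self_nonneg a
    apply Complex.ext
    · exact le_antisymm h h1
    · rw [trace_star_mul_self, Complex.ofReal_im]; rfl
  exact (hsCore A).definite a h0

theorem ext_Tr {a b : A} (h : ∀ c : A, Tr (star c * a) = Tr (star c * b)) : a = b := by
  rw [← sub_eq_zero]
  apply eq_zero_of_re_Tr_star_mul_self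
  rw [mul_sub, map_sub, h, sub_self]
  rfl

theorem re_Tr_nonneg {a : A} (h : 0 ≤ (a : H →L[ℂ] H)) : 0 ≤ (Tr a).re := by
  have h1 := LinearMap.trace_eq_sum_inner
    ((a : H →L[ℂ] H) : H →ₗ[ℂ] H) (stdOrthonormalBasis ℂ H)
  rw [show (Tr a : ℂ) = _ from h1, Complex.re_sum]
  refine Finset.sum_nonneg fun i _ => ?_
  exact ((ContinuousLinearMap.nonneg_iff_isPositive _).1 h).re_inner_nonneg_right _

theorem hsAdjoint_eq_of_Tr {T : A →ₗ[ℂ] B} {S : B →ₗ[ℂ] A}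
    (h : ∀ a b, Tr (star (S b) * a) = Tr (star b * T a)) : hsAdjoint T = S := by
  ext1 b
  refine ext_Tr fun c => ?_
  have e : ∀ y : A, Tr (star c * y) = starRingEnd ℂ (Tr (star y * c)) := fun y => by
    rw [← Tr_star, star_mul, star_star]
  rw [e, e, Tr_hsAdjoint, h]

theorem IsUnitalSchwarz.isSelfAdjoint_map {Φ : A →ₗ[ℂ] B} (h : IsUnitalSchwarz Φ) (c : A) :
    star (Φ (star c * c)) = Φ (star c * c) := by
  have h1 : 0 ≤ ((Φ (star c * c) : B) : K →L[ℂ] K) :=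
    le_trans (star_mul_self_nonneg ((Φ c : B) : K →L[ℂ] K)) (h.2 c)
  exact Subtype.ext (IsSelfAdjoint.of_nonneg h1)

theorem polarization {R : Type*} [Ring R] [StarRing R] [Algebra ℂ R] [StarModule ℂ R] (a : R) :
    a = (1 / 4 : ℂ) • ((star (1 + a) * (1 + a) - star (1 - a) * (1 - a))
      - Complex.I • (star (1 + Complex.I • a) * (1 + Complex.I • a)
        - star (1 - Complex.I • a) * (1 - Complex.I • a))) := by
  simp only [star_add, star_sub, star_one, star_smul, Complex.star_def, Complex.conj_I,
    add_mul, mul_add, sub_mul, mul_sub, one_mul, mul_one, smul_sub, smul_add, smul_smul,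
    smul_mul_assoc, mul_smul_comm, neg_smul, smul_neg, neg_mul, Complex.I_mul_I]
  module

/-- A Schwarz map sends each `c* c` to a positive, hence self-adjoint, element, and by polarization
such elements span. -/
theorem IsUnitalSchwarz.map_star {Φ : A →ₗ[ℂ] B} (h : IsUnitalSchwarz Φ) (a : A) :
    Φ (star a) = star (Φ a) := by
  have h1 := polarization a
  set p := star (1 + a) * (1 + a) with hp
  set q := star (1 - a) * (1 - a) with hq
  set r := star (1 + Complex.I • a) * (1 + Complex.I • a) with hr
  set s := star (1 - Complex.I • a) * (1 - Complex.I • a) with hs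
  have hp' : star (Φ p) = Φ p := h.isSelfAdjoint_map _
  have hq' : star (Φ q) = Φ q := h.isSelfAdjoint_map _
  have hr' : star (Φ r) = Φ r := h.isSelfAdjoint_map _
  have hs' : star (Φ s) = Φ s := h.isSelfAdjoint_map _
  have ep : star p = p := by simp [hp]
  have eq : star q = q := by simp only [hq, star_mul, star_star]
  have er : star r = r := by simp only [hr, star_mul, star_star]
  have es : star s = s := by simp only [hs, star_mul, star_star]
  -- With the four squares opaque, `h1` expresses `a` without circularity and can be substituted.
  clear_value p q r s
  subst h1
  simp only [star_smul, star_sub, map_smul, map_sub, hp', hq', hr', hs', ep, eq, er, es]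

variable {T : A →ₗ[ℂ] B}

theorem Tr_hsAdjoint_mul (hT : IsUnitalSchwarz (hsAdjoint T)) (a : A) (b : B) :
    Tr (hsAdjoint T b * a) = Tr (b * T a) := by
  have := Tr_hsAdjoint T a (star b)
  rwa [hT.map_star, star_star, star_star] at this

theorem map_star_of_hsAdjoint (hT : IsUnitalSchwarz (hsAdjoint T)) (a : A) :
    T (star a) = star (T a) := by
  refine ext_Tr fun c => ?_
  rw [← Tr_hsAdjoint, ← star_star (star _ * star a), ← star_star (star c * star (T a)), Tr_star,
    Tr_star (star (star c * _))]
  simp only [star_mul, star_star]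
  rw [Tr_mul_comm, Tr_hsAdjoint_mul hT, Tr_mul_comm]

/-- Self-adjoint elements whose spectrum consists of positive reals. -/
def PosSpec (ρ : A) : Prop :=
  IsSelfAdjoint ρ ∧ ∀ z ∈ spec ρ, ∃ r : ℝ, 0 < r ∧ z = r

/-- Testing on the spectral projection of `z` gives `z · Tr p_z ≥ 0`. The trace form of the
hypothesis is the one that passes from `ρ` to `T(ρ)` by duality. -/
theorem posSpec_of_Tr_nonneg {ρ : A} (hs : IsSelfAdjoint ρ) (hu : IsUnit ρ)
    (h : ∀ a : A, 0 ≤ (Tr (ρ * (star a * a))).re) : PosSpec ρ := by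
  refine ⟨hs, fun z hz => ⟨z.re, ?_, ?_⟩⟩
  swap
  · exact hs.mem_spectrum_eq_re (mem_spec.1 hz)
  have hn : IsStarNormal ρ := hs.isStarNormal
  have hre : z = z.re := hs.mem_spectrum_eq_re (mem_spec.1 hz)
  have h0 : z ≠ 0 := by
    rintro rfl
    exact spectrum.zero_notMem ℂ hu (mem_spec.1 hz)
  have h1 := h (sproj ρ z)
  rw [star_sproj, ← mul_assoc, mul_sproj ρ hz, smul_mul_assoc, map_smul, smul_eq_mul, hre,
    Complex.re_ofReal_mul, ← hre] at h1
  have h2 : 0 < (Tr (sproj ρ z * sproj ρ z)).re := by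
    by_contra hc
    refine sproj_ne_zero ρ hz (eq_zero_of_re_Tr_star_mul_self ?_)
    rw [star_sproj]
    exact not_lt.1 hc
  have h3 : z.re ≠ 0 := by
    intro h3; rw [h3] at hre; exact h0 (by simpa using hre)
  exact lt_of_le_of_ne (nonneg_of_mul_nonneg_left h1 h2) h3.symm

theorem PosSpec.isStarNormal {ρ : A} (h : PosSpec ρ) : IsStarNormal ρ := h.1.isStarNormal

theorem PosSpec.cpower_mul {ρ : A} (h : PosSpec ρ) (z w : ℂ) :
    cpower ρ z * cpower ρ w = cpower ρ (z + w) := by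
  rw [cpower, cpower, cpower, ← cfc_mul _ _ _ (continuousOn_spectrum _ _)
    (continuousOn_spectrum _ _)]
  refine cfc_congr fun v hv => ?_
  obtain ⟨r, hr, rfl⟩ := h.2 v (mem_spec.2 hv)
  exact (Complex.cpow_add _ _ (by exact_mod_cast hr.ne')).symm

theorem PosSpec.cpower_zero {ρ : A} (h : PosSpec ρ) : cpower ρ 0 = 1 := by
  have := h.isStarNormal
  simp only [cpower, Complex.cpow_zero]
  exact cfc_const_one ℂ ρ

theorem PosSpec.cpower_one {ρ : A} (h : PosSpec ρ) : cpower ρ 1 = ρ := by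
  have := h.isStarNormal
  simp only [cpower, Complex.cpow_one]
  exact cfc_id' ℂ ρ

theorem PosSpec.star_cpower {ρ : A} (h : PosSpec ρ) (t : ℝ) :
    star (cpower ρ t) = cpower ρ t := by
  rw [cpower, ← cfc_star]
  refine cfc_congr fun v hv => ?_
  obtain ⟨r, hr, rfl⟩ := h.2 v (mem_spec.2 hv)
  change star ((r : ℂ) ^ (t : ℂ)) = _
  rw [← Complex.ofReal_cpow hr.le]
  simp

/-- A self-adjoint invertible square root. -/
theorem PosSpec.exists_sqrt {ρ : A} (h : PosSpec ρ) :
    ∃ r s : A, star r = r ∧ star s = s ∧ r * r = ρ ∧ s * r = 1 := by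
  refine ⟨cpower ρ (1 / 2 : ℝ), cpower ρ (-1 / 2 : ℝ), h.star_cpower _, h.star_cpower _, ?_, ?_⟩
  · rw [h.cpower_mul]
    norm_num [h.cpower_one]
  · rw [h.cpower_mul]
    norm_num [h.cpower_zero]

theorem PosSpec.re_Tr_mul_nonneg {ρ : A} (h : PosSpec ρ) {a : A} (ha : 0 ≤ (a : H →L[ℂ] H)) :
    0 ≤ (Tr (ρ * a)).re := by
  obtain ⟨r, s, h1, -, h2, -⟩ := h.exists_sqrt
  rw [← h2, mul_assoc, Tr_mul_comm]
  apply re_Tr_nonneg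
  have := star_right_conjugate_nonneg ha (r : H →L[ℂ] H)
  have e : star (r : H →L[ℂ] H) = r := congrArg Subtype.val h1
  rw [e] at this
  exact this

theorem PosSpec.eq_zero_of_re_Tr {ρ : A} (h : PosSpec ρ) {a : A}
    (ha : (Tr (star a * (ρ * a))).re ≤ 0) : a = 0 := by
  obtain ⟨r, s, h1, -, h2, h3⟩ := h.exists_sqrt
  have : r * a = 0 := by
    apply eq_zero_of_re_Tr_star_mul_self
    rwa [star_mul, h1, mul_assoc, ← mul_assoc r, h2]
  rw [← one_mul a, ← h3, mul_assoc, this, mul_zero]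

theorem posSpec_of_isDensity {ρ : A} (h : IsDensity ρ) (hu : IsUnit ρ) : PosSpec ρ := by
  refine posSpec_of_Tr_nonneg (Subtype.ext (IsSelfAdjoint.of_nonneg h.1)) hu fun a => ?_
  rw [← mul_assoc, Tr_mul_comm]
  apply re_Tr_nonneg
  have := star_right_conjugate_nonneg h.1 (a : H →L[ℂ] H)
  rw [mul_assoc] at this
  exact this

theorem posSpec_map {ρ : A} (h : PosSpec ρ) (hT : IsUnitalSchwarz (hsAdjoint T))
    (hu : IsUnit (T ρ)) : PosSpec (T ρ) := by
  refine posSpec_of_Tr_nonneg ?_ hu fun b => ?_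
  · rw [IsSelfAdjoint, ← map_star_of_hsAdjoint hT, h.1]
  · rw [Tr_mul_comm, ← Tr_hsAdjoint_mul hT, Tr_mul_comm]
    exact h.re_Tr_mul_nonneg
      (le_trans (star_mul_self_nonneg ((hsAdjoint T b : A) : H →L[ℂ] H)) (hT.2 b))

/-- The Schwarz inequality for `T*` is paired with `ρ`, and `T*` is then moved onto `ρ` by duality.
-/
theorem re_Tr_hsAdjoint_le {ρ : A} (h : PosSpec ρ) (hT : IsUnitalSchwarz (hsAdjoint T)) (b : B) :
    (Tr (ρ * (star (hsAdjoint T b) * hsAdjoint T b))).re ≤ (Tr (T ρ * (star b * b))).re := by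
  have h1 : 0 ≤ ((hsAdjoint T (star b * b) - star (hsAdjoint T b) * hsAdjoint T b : A) :
      H →L[ℂ] H) := sub_nonneg.2 (hT.2 b)
  have h2 := h.re_Tr_mul_nonneg h1
  rw [mul_sub, map_sub, Complex.sub_re, Tr_mul_comm, Tr_hsAdjoint_mul hT, Tr_mul_comm] at h2
  exact sub_nonneg.1 h2

end Trace

/-! ### Functions of the modular operator and their quadratic forms -/

section ModularCalculus

variable {A : StarSubalgebra ℂ (H →L[ℂ] H)} {B : StarSubalgebra ℂ (K →L[ℂ] K)}

/-- The element `h(Δ_ρ)(x ρ⁻¹)`, through the spectral projections of `ρ`. -/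
def modFun (ρ : A) (h : ℝ → ℂ) (x : A) : A := schur ρ (fun z w => h (z / w).re / w) x

theorem PosSpec.isUnit {ρ : A} (h : PosSpec ρ) : IsUnit ρ := by
  refine ⟨⟨ρ, cpower ρ (-1), ?_, ?_⟩, rfl⟩
  · nth_rewrite 1 [← h.cpower_one]
    rw [h.cpower_mul, add_neg_cancel, h.cpower_zero]
  · nth_rewrite 2 [← h.cpower_one]
    rw [h.cpower_mul, neg_add_cancel, h.cpower_zero]

theorem PosSpec.ne_zero {ρ : A} (h : PosSpec ρ) {z : ℂ} (hz : z ∈ spec ρ) : z ≠ 0 := by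
  obtain ⟨r, hr, rfl⟩ := h.2 z hz
  exact_mod_cast hr.ne'

theorem PosSpec.div_pos {ρ : A} (h : PosSpec ρ) {z w : ℂ} (hz : z ∈ spec ρ) (hw : w ∈ spec ρ) :
    0 < (z / w).re ∧ z / w = ((z / w).re : ℂ) := by
  obtain ⟨r, hr, rfl⟩ := h.2 z hz
  obtain ⟨s, hs, rfl⟩ := h.2 w hw
  rw [← Complex.ofReal_div, Complex.ofReal_re]
  exact ⟨_root_.div_pos hr hs, rfl⟩

theorem hasEigenvector_modularOp {ρ : A} (h : PosSpec ρ) {z w : ℂ} (hz : z ∈ spec ρ)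
    (hw : w ∈ spec ρ) {a : A} (h0 : sproj ρ z * a * sproj ρ w ≠ 0) :
    Module.End.HasEigenvector (modularOp ρ) ((z / w).re : ℂ) (sproj ρ z * a * sproj ρ w) := by
  have := h.isStarNormal
  refine ⟨?_, h0⟩
  rw [Module.End.mem_eigenspace_iff, ← (h.div_pos hz hw).2]
  have h1 : sproj ρ w * Ring.inverse ρ = w⁻¹ • sproj ρ w := by
    have h2 : sproj ρ w = (w⁻¹ • sproj ρ w) * ρ := by
      rw [smul_mul_assoc, sproj_mul ρ hw, smul_smul, inv_mul_cancel₀ (h.ne_zero hw), one_smul]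
    nth_rewrite 1 [h2]
    rw [mul_assoc, Ring.mul_inverse_cancel _ h.isUnit, mul_one]
  change ρ * (sproj ρ z * a * sproj ρ w * Ring.inverse ρ) = _
  rw [mul_assoc _ (sproj ρ w), h1, mul_smul_comm, mul_smul_comm, ← mul_assoc, ← mul_assoc,
    mul_sproj ρ hz, smul_mul_assoc, smul_mul_assoc, smul_smul, div_eq_inv_mul]

theorem opFun_modularOp {ρ : A} (h : PosSpec ρ) (f : ℝ → ℝ) (a : A) :
    opFun f (modularOp ρ) a = schur ρ (fun z w => (f (z / w).re : ℂ)) a := by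
  have := h.isStarNormal
  nth_rewrite 1 [← schur_one ρ a]
  simp only [schur_apply, one_smul, map_sum]
  refine Finset.sum_congr rfl fun z hz => Finset.sum_congr rfl fun w hw => ?_
  by_cases h0 : sproj ρ z * a * sproj ρ w = 0
  · simp [h0]
  · exact opFun_apply_of_eigenvector f _ _ _ (hasEigenvector_modularOp h hz hw h0)

/-- `J^f_ρ` is the Schur multiplier `f(z/w) w`, nonzero on the spectrum, so the reciprocal
multiplier is a two-sided inverse. `Ring.inverse` would be zero without one. -/
theorem inverse_JOp {ρ : A} (h : PosSpec ρ) {f : ℝ → ℝ} (hf : ∀ t, 0 < t → 0 < f t) (a : A) :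
    Ring.inverse (JOp f ρ) a = modFun ρ (fun t => ((f t)⁻¹ : ℝ)) a := by
  have := h.isStarNormal
  have hJ : JOp f ρ = schur ρ (fun z w => (f (z / w).re : ℂ) * w) := by
    ext1 a
    change opFun f (modularOp ρ) (a * ρ) = _
    rw [opFun_modularOp h, ← schur_snd, schur_schur]
  set N : Module.End ℂ A := schur ρ (fun z w => (((f (z / w).re)⁻¹ : ℝ) : ℂ) / w) with hN
  have key : ∀ z ∈ spec ρ, ∀ w ∈ spec ρ,
      (f (z / w).re : ℂ) * w * ((((f (z / w).re)⁻¹ : ℝ) : ℂ) / w) = 1 := by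
    intro z hz w hw
    have h1 : (f (z / w).re : ℂ) ≠ 0 := by exact_mod_cast (hf _ (h.div_pos hz hw).1).ne'
    have h2 := h.ne_zero hw
    push_cast
    field_simp
  have h1 : JOp f ρ * N = 1 := by
    ext1 a
    rw [Module.End.mul_apply, hJ, hN, schur_schur, Module.End.one_apply]
    nth_rewrite 2 [← schur_one ρ a]
    exact schur_congr fun z hz w hw _ => key z hz w hw
  have h2 : N * JOp f ρ = 1 := by
    ext1 a
    rw [Module.End.mul_apply, hJ, hN, schur_schur, Module.End.one_apply]
    nth_rewrite 2 [← schur_one ρ a]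
    exact schur_congr fun z hz w hw _ => by rw [mul_comm]; exact key z hz w hw
  have h3 : Ring.inverse (JOp f ρ) = N := Ring.inverse_unit ⟨JOp f ρ, N, h1, h2⟩
  rw [h3]
  rfl

theorem monotoneMetric_eq {ρ : A} (h : PosSpec ρ) {f : ℝ → ℝ} (hf : ∀ t, 0 < t → 0 < f t)
    (x y : A) :
    monotoneMetric f ρ x y = Tr (modFun ρ (fun t => ((f t)⁻¹ : ℝ)) x * y) := by
  rw [monotoneMetric, inverse_JOp h hf]

theorem modFun_congr {ρ : A} (h : PosSpec ρ) {g k : ℝ → ℂ} {F : Set ℂ}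
    (hF : spectrum ℂ (modularOp ρ) ⊆ F) (hgk : ∀ t : ℝ, 0 < t → (t : ℂ) ∈ F → g t = k t) (x : A) :
    modFun ρ g x = modFun ρ k x := by
  refine schur_congr fun z hz w hw h0 => ?_
  rw [hgk _ (h.div_pos hz hw).1]
  exact hF (Module.End.hasEigenvalue_of_hasEigenvector
    (hasEigenvector_modularOp h hz hw h0)).mem_spectrum

theorem modFun_sum {ι : Type*} (s : Finset ι) (ρ : A) (c : ι → ℂ) (h : ι → ℝ → ℂ) (x : A) :
    modFun ρ (fun t => ∑ i ∈ s, c i * h i t) x = ∑ i ∈ s, c i • modFun ρ (h i) x := by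
  simp only [modFun]
  rw [← schur_sum]
  simp only [Finset.sum_div, mul_div_assoc]

/-- On the block of `(v, w)` the multiplier is `v^z w^{-z-1} = (v/w)^z / w`. At `z = -1/2` both
exponents are `-1/2`. -/
theorem cpower_mul_mul_cpower {ρ : A} (h : PosSpec ρ) (z : ℂ) (x : A) :
    cpower ρ z * x * cpower ρ (-z - 1) = modFun ρ (fun t => (t : ℂ) ^ z) x := by
  have := h.isStarNormal
  rw [cpower, cpower, cfc_mul_mul_cfc]
  refine schur_congr fun v hv w hw _ => ?_
  obtain ⟨r, hr, rfl⟩ := h.2 v hv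
  obtain ⟨s, hs, rfl⟩ := h.2 w hw
  have hs' : (s : ℂ) ≠ 0 := by exact_mod_cast hs.ne'
  have e : ((r : ℂ)) = ((r / s : ℝ) : ℂ) * (s : ℂ) := by
    push_cast; field_simp
  rw [← Complex.ofReal_div, Complex.ofReal_re, Complex.cpow_sub _ _ hs', Complex.cpow_neg,
    Complex.cpow_one]
  nth_rewrite 1 [e]
  rw [Complex.mul_cpow_ofReal_nonneg (by positivity) hs.le]
  have : (s : ℂ) ^ z ≠ 0 := by simp [Complex.cpow_eq_zero_iff, hs']
  field_simp

/-- The quadratic form `Re Tr x* g(Δ_ρ)(x ρ⁻¹)`. -/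
def quad (ρ : A) (g : ℝ → ℝ) (x : A) : ℝ := (Tr (star x * modFun ρ (fun t => (g t : ℂ)) x)).re

/-- The coefficients of the quadratic form `quad`. -/
def coeff (ρ x : A) (z w : ℂ) : ℝ := (Tr (star x * (sproj ρ z * x * sproj ρ w)) / w).re

theorem quad_eq_sum (ρ : A) (g : ℝ → ℝ) (x : A) :
    quad ρ g x = ∑ z ∈ spec ρ, ∑ w ∈ spec ρ, g (z / w).re * coeff ρ x z w := by
  simp only [quad, modFun, schur_apply, Finset.mul_sum, map_sum, Complex.re_sum, mul_smul_comm,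
    map_smul, smul_eq_mul, coeff]
  refine Finset.sum_congr rfl fun z _ => Finset.sum_congr rfl fun w _ => ?_
  rw [div_mul_eq_mul_div, mul_div_assoc, Complex.re_ofReal_mul]

/-- The resolvent function `t ↦ (α + β t)⁻¹`. -/
def resolv (α β t : ℝ) : ℝ := (α + β * t)⁻¹

/-- The operator `α R_ρ + β L_ρ`. -/
def mulComb (ρ : A) (α β : ℝ) : A →ₗ[ℂ] A :=
  (α : ℂ) • LinearMap.mulRight ℂ ρ + (β : ℂ) • LinearMap.mulLeft ℂ ρ

theorem mulComb_apply (ρ : A) (α β : ℝ) (a : A) :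
    mulComb ρ α β a = (α : ℂ) • (a * ρ) + (β : ℂ) • (ρ * a) := rfl

/-- Either parameter may vanish: `(1, 0)` serves the constant `c` of the integral representation,
and `(0, 1)` the point `s = 0`. -/
theorem mulComb_modFun {ρ : A} (h : PosSpec ρ) {α β : ℝ} (hα : 0 ≤ α) (hβ : 0 ≤ β)
    (hαβ : 0 < α + β) (x : A) :
    mulComb ρ α β (modFun ρ (fun t => (resolv α β t : ℂ)) x) = x := by
  have := h.isStarNormal
  have h1 (a : A) : mulComb ρ α β a = schur ρ (fun z w => α * w + β * z) a := by
    rw [mulComb_apply, ← schur_fst ρ, ← schur_snd ρ]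
    simp only [schur_apply ρ, add_smul, mul_smul, Finset.sum_add_distrib, Finset.smul_sum]
  rw [h1, modFun, schur_schur]
  nth_rewrite 2 [← schur_one ρ x]
  refine schur_congr fun z hz w hw _ => ?_
  obtain ⟨r, hr, rfl⟩ := h.2 z hz
  obtain ⟨s, hs, rfl⟩ := h.2 w hw
  have h2 : 0 < α * s + β * r := by
    rcases hα.eq_or_lt with rfl | hα'
    · have : 0 < β := by linarith
      positivity
    · positivity
  rw [← Complex.ofReal_div r s, Complex.ofReal_re, resolv]
  have h3 : α + β * (r / s) = (α * s + β * r) / s := by field_simp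
  have h4 : ((α : ℂ) * s + β * r) ≠ 0 := by exact_mod_cast h2.ne'
  have h5 : (s : ℂ) ≠ 0 := by exact_mod_cast hs.ne'
  rw [h3]
  push_cast
  field_simp

theorem Tr_star_mulComb {ρ : A} (h : PosSpec ρ) (α β : ℝ) (a b : A) :
    Tr (star a * mulComb ρ α β b) = starRingEnd ℂ (Tr (star b * mulComb ρ α β a)) := by
  rw [← Tr_star, star_mul, star_star, mulComb_apply, mulComb_apply, star_add, star_smul, star_smul,
    star_mul, star_mul, h.1.star_eq, mul_add, add_mul, map_add, map_add]
  simp only [mul_smul_comm, smul_mul_assoc, map_smul, Complex.star_def, Complex.conj_ofReal]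
  rw [← mul_assoc, Tr_mul_comm, ← mul_assoc, mul_assoc (star a)]

theorem re_Tr_star_mulComb (ρ : A) (α β : ℝ) (a : A) :
    (Tr (star a * mulComb ρ α β a)).re
      = α * (Tr (ρ * (star a * a))).re + β * (Tr (ρ * (a * star a))).re := by
  rw [mulComb_apply, mul_add, map_add, mul_smul_comm, mul_smul_comm, map_smul, map_smul,
    smul_eq_mul, smul_eq_mul, Complex.add_re, Complex.re_ofReal_mul, Complex.re_ofReal_mul,
    ← mul_assoc, Tr_mul_comm _ ρ, Tr_mul_comm (star a), mul_assoc ρ]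

theorem re_Tr_mul_star_mul_nonneg {ρ : A} (h : PosSpec ρ) (a : A) :
    0 ≤ (Tr (ρ * (star a * a))).re :=
  h.re_Tr_mul_nonneg (star_mul_self_nonneg (a : H →L[ℂ] H))

theorem eq_zero_of_re_Tr_mul_star_mul {ρ : A} (h : PosSpec ρ) {a : A}
    (ha : (Tr (ρ * (star a * a))).re ≤ 0) : a = 0 := by
  rw [← star_eq_zero]
  apply h.eq_zero_of_re_Tr
  rwa [star_star, Tr_mul_comm, mul_assoc]

theorem re_Tr_star_mulComb_nonneg {ρ : A} (h : PosSpec ρ) {α β : ℝ} (hα : 0 ≤ α) (hβ : 0 ≤ β)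
    (a : A) : 0 ≤ (Tr (star a * mulComb ρ α β a)).re := by
  rw [re_Tr_star_mulComb]
  have h1 := re_Tr_mul_star_mul_nonneg h a
  have h2 := re_Tr_mul_star_mul_nonneg h (star a)
  rw [star_star] at h2
  positivity

theorem eq_zero_of_re_Tr_star_mulComb {ρ : A} (h : PosSpec ρ) {α β : ℝ} (hα : 0 ≤ α)
    (hβ : 0 ≤ β) (hαβ : 0 < α + β) {a : A} (ha : (Tr (star a * mulComb ρ α β a)).re ≤ 0) :
    a = 0 := by
  rw [re_Tr_star_mulComb] at ha
  have h1 := re_Tr_mul_star_mul_nonneg h a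
  have h2 := re_Tr_mul_star_mul_nonneg h (star a)
  rw [star_star] at h2
  have h3 := mul_nonneg hα h1
  have h4 := mul_nonneg hβ h2
  rcases hα.eq_or_lt with rfl | hα'
  · have hβ' : 0 < β := by linarith
    rw [← star_eq_zero]
    apply eq_zero_of_re_Tr_mul_star_mul h
    rw [star_star]
    exact nonpos_of_mul_nonpos_right (by linarith) hβ'
  · exact eq_zero_of_re_Tr_mul_star_mul h (nonpos_of_mul_nonpos_right (by linarith) hα')

/-- The form splits into `α Tr ρ a*a + β Tr ρ aa*`; the trace inequality is applied to `b` and to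
`b*`. -/
theorem re_Tr_mulComb_hsAdjoint_le {ρ : A} (h : PosSpec ρ) {α β : ℝ} (hα : 0 ≤ α) (hβ : 0 ≤ β)
    {T : A →ₗ[ℂ] B} (hT : IsUnitalSchwarz (hsAdjoint T)) (b : B) :
    (Tr (star (hsAdjoint T b) * mulComb ρ α β (hsAdjoint T b))).re
      ≤ (Tr (star b * mulComb (T ρ) α β b)).re := by
  rw [re_Tr_star_mulComb, re_Tr_star_mulComb]
  have h1 := re_Tr_hsAdjoint_le h hT b
  have h2 := re_Tr_hsAdjoint_le h hT (star b)
  rw [hT.map_star, star_star, star_star] at h2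
  exact add_le_add (mul_le_mul_of_nonneg_left h1 hα) (mul_le_mul_of_nonneg_left h2 hβ)

theorem re_Tr_sub_mulComb_sub {ρ : A} (h : PosSpec ρ) (α β : ℝ) (a y : A) :
    (Tr (star (a - y) * mulComb ρ α β (a - y))).re
      = (Tr (star a * mulComb ρ α β a)).re - 2 * (Tr (star y * mulComb ρ α β a)).re
        + (Tr (star y * mulComb ρ α β y)).re := by
  rw [map_sub, star_sub, sub_mul, mul_sub, mul_sub, map_sub, map_sub, map_sub,
    Tr_star_mulComb h α β a y]
  simp only [Complex.sub_re, Complex.conj_re]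
  ring

theorem quad_eq_re_Tr (ρ : A) (g : ℝ → ℝ) (x : A) :
    quad ρ g x = (Tr (star (modFun ρ (fun t => (g t : ℂ)) x) * x)).re := by
  rw [quad, ← Complex.conj_re, ← Tr_star, star_mul, star_star]

/-- Let `M` be `αR + βL` at `ρ`, `N` the same at `T(ρ)`, `a = M⁻¹x`, `b = N⁻¹T(x)`, `y = T*b`. Then
`0 ≤ ⟨a-y, M(a-y)⟩ = ⟨a, x⟩ - 2 Re⟨b, T(x)⟩ + ⟨y, My⟩`, and `⟨y, My⟩ ≤ ⟨b, Nb⟩ = ⟨b, T(x)⟩`.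
Equality of the two forms makes the square vanish, so `a = y` by definiteness of `M`. -/
theorem quad_resolv_gap {ρ : A} (h : PosSpec ρ) {α β : ℝ} (hα : 0 ≤ α) (hβ : 0 ≤ β)
    (hαβ : 0 < α + β) {T : A →ₗ[ℂ] B} (hT : IsUnitalSchwarz (hsAdjoint T)) (hσ : PosSpec (T ρ))
    (x : A) :
    quad (T ρ) (resolv α β) (T x) ≤ quad ρ (resolv α β) x ∧
      (quad ρ (resolv α β) x ≤ quad (T ρ) (resolv α β) (T x) →
        modFun ρ (fun t => (resolv α β t : ℂ)) x
          = hsAdjoint T (modFun (T ρ) (fun t => (resolv α β t : ℂ)) (T x))) := by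
  set a := modFun ρ (fun t => (resolv α β t : ℂ)) x with ha
  set b := modFun (T ρ) (fun t => (resolv α β t : ℂ)) (T x) with hb
  set y := hsAdjoint T b with hy
  have hMa : mulComb ρ α β a = x := mulComb_modFun h hα hβ hαβ x
  have hMb : mulComb (T ρ) α β b = T x := mulComb_modFun hσ hα hβ hαβ (T x)
  have hle := re_Tr_mulComb_hsAdjoint_le h hα hβ hT b
  have hexp := re_Tr_sub_mulComb_sub h α β a y
  rw [hMa, hy, Tr_hsAdjoint, ← hy] at hexp
  rw [hMb, ← hy] at hle
  have hpos := re_Tr_star_mulComb_nonneg h hα hβ (a - y)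
  rw [quad_eq_re_Tr, quad_eq_re_Tr, ← ha, ← hb]
  refine ⟨by linarith, fun heq => ?_⟩
  have h1 : a - y = 0 := eq_zero_of_re_Tr_star_mulComb h hα hβ hαβ (by linarith)
  exact sub_eq_zero.1 h1

end ModularCalculus

/-! ### Spanning families of functions on the modular spectra -/

section Interpolation

/-- Partial fractions: a polynomial `q` of degree below `|S|` interpolates `h(t) ∏ (t + s)` on `F`.
Lagrange interpolation of `q` at the nodes `-s`, divided by the nodal polynomial, is a combination
of the `(s + t)⁻¹`. -/
theorem exists_resolv_combination (F S : Finset ℝ) (hF : ∀ t ∈ F, 0 < t) (hS : ∀ s ∈ S, 0 ≤ s)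
    (hcard : F.card ≤ S.card) (h : ℝ → ℂ) :
    ∃ c : ℝ → ℂ, ∀ t ∈ F, h t = ∑ s ∈ S, c s * (resolv s 1 t : ℂ) := by
  have hF' : Set.InjOn (fun t : ℝ => (t : ℂ)) F := Complex.ofReal_injective.injOn
  set v : ℝ → ℂ := fun s => -(s : ℂ) with hv
  have hS' : Set.InjOn v S := fun a _ b _ hab => by simpa [hv] using hab
  set q := Lagrange.interpolate F (fun t : ℝ => (t : ℂ))
    (fun t => h t * (Lagrange.nodal S v).eval (t : ℂ)) with hq
  have hdeg : q.degree < S.card :=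
    lt_of_lt_of_le (Lagrange.degree_interpolate_lt _ hF') (by exact_mod_cast hcard)
  have hq' : q = Lagrange.interpolate S v (fun i => q.eval (v i)) :=
    Lagrange.eq_interpolate hS' hdeg
  refine ⟨fun s => Lagrange.nodalWeight S v s * q.eval (v s), fun t ht => ?_⟩
  have hne : ∀ s ∈ S, (t : ℂ) ≠ v s := by
    intro s hs heq
    have h1 : t = -s := by
      simp only [hv] at heq
      exact_mod_cast heq
    linarith [hF t ht, hS s hs]
  have h1 : q.eval (t : ℂ) = h t * (Lagrange.nodal S v).eval (t : ℂ) :=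
    Lagrange.eval_interpolate_at_node _ hF' ht
  have h2 := Lagrange.eval_interpolate_not_at_node (fun i => q.eval (v i)) hne
  rw [← hq', h1, mul_comm] at h2
  have h3 : (Lagrange.nodal S v).eval (t : ℂ) ≠ 0 := by
    rw [Lagrange.eval_nodal, Finset.prod_ne_zero_iff]
    exact fun s hs => sub_ne_zero.2 (hne s hs)
  rw [mul_left_cancel₀ h3 h2]
  refine Finset.sum_congr rfl fun s _ => ?_
  simp only [resolv, hv, one_mul, sub_neg_eq_add]
  push_cast
  rw [add_comm (t : ℂ)]
  ring

theorem exists_imaginary_power_combination (F : Finset ℝ) (hF : ∀ t ∈ F, 0 < t) (h : ℝ → ℂ) :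
    ∃ (n : ℕ) (c : ℕ → ℂ) (u : ℕ → ℝ), ∀ t ∈ F,
      h t = ∑ k ∈ Finset.range n, c k * (t : ℂ) ^ (Complex.I * (u k : ℂ)) := by
  -- This scale gives `|δ log t| ≤ 1 < π` on `F`, so `t ↦ t^{iδ}` is injective there; a polynomial
  -- in `t^{iδ}` then interpolates `h`.
  set δ : ℝ := (1 + ∑ t ∈ F, |Real.log t|)⁻¹ with hδ
  have hsum : 0 ≤ ∑ t ∈ F, |Real.log t| := Finset.sum_nonneg fun _ _ => abs_nonneg _
  have hδ0 : 0 < δ := by positivity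
  have hbd : ∀ t ∈ F, |δ * Real.log t| ≤ 1 := by
    intro t ht
    have h1 : |Real.log t| ≤ ∑ t ∈ F, |Real.log t| :=
      Finset.single_le_sum (f := fun t => |Real.log t|) (fun _ _ => abs_nonneg _) ht
    rw [abs_mul, abs_of_pos hδ0, hδ, inv_mul_le_one₀ (by positivity)]
    linarith
  set v : ℝ → ℂ := fun t => (t : ℂ) ^ (Complex.I * (δ : ℂ)) with hv
  have hexp : ∀ t ∈ F, v t = Complex.exp (((δ * Real.log t : ℝ) : ℂ) * Complex.I) := by
    intro t ht
    have h0 : (t : ℂ) ≠ 0 := by exact_mod_cast (hF t ht).ne'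
    simp only [hv]
    rw [Complex.cpow_def_of_ne_zero h0, ← Complex.ofReal_log (hF t ht).le]
    congr 1
    push_cast
    ring
  have hinj : Set.InjOn v F := by
    intro a ha b hb hab
    rw [hexp a ha, hexp b hb] at hab
    have h1 := abs_le.1 (hbd a ha)
    have h2 := abs_le.1 (hbd b hb)
    have hpi := Real.pi_gt_three
    have h3 := Complex.exp_inj_of_neg_pi_lt_of_le_pi
      (by rw [Complex.im_ofReal_mul, Complex.I_im]; linarith)
      (by rw [Complex.im_ofReal_mul, Complex.I_im]; linarith)
      (by rw [Complex.im_ofReal_mul, Complex.I_im]; linarith)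
      (by rw [Complex.im_ofReal_mul, Complex.I_im]; linarith) hab
    have h4 := mul_right_cancel₀ Complex.I_ne_zero h3
    have h5 : δ * Real.log a = δ * Real.log b := by exact_mod_cast h4
    exact Real.log_injOn_pos (hF a ha) (hF b hb) (mul_left_cancel₀ hδ0.ne' h5)
  set q := Lagrange.interpolate F v h with hq
  refine ⟨q.natDegree + 1, q.coeff, fun k => δ * k, fun t ht => ?_⟩
  rw [← Lagrange.eval_interpolate_at_node h hinj ht, ← hq, Polynomial.eval_eq_sum_range]
  refine Finset.sum_congr rfl fun k _ => ?_
  have : Complex.I * ((δ * k : ℝ) : ℂ) = Complex.I * δ * k := by push_cast; ring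
  rw [this, Complex.cpow_mul_nat]

variable {A : StarSubalgebra ℂ (H →L[ℂ] H)} {B : StarSubalgebra ℂ (K →L[ℂ] K)}

theorem modFun_eq_of_combination {ρ : A} {σ : B} (hρ : PosSpec ρ) (hσ : PosSpec σ)
    (Φ : B →ₗ[ℂ] A) (x : A) (y : B) {ι : Type*} (S : Finset ι) (c : ι → ℂ) (g : ι → ℝ → ℂ)
    (h : ℝ → ℂ)
    (hF : ∀ t : ℝ, 0 < t → (t : ℂ) ∈ spectrum ℂ (modularOp ρ) ∪ spectrum ℂ (modularOp σ) →
      h t = ∑ i ∈ S, c i * g i t)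
    (hE : ∀ i ∈ S, modFun ρ (g i) x = Φ (modFun σ (g i) y)) :
    modFun ρ h x = Φ (modFun σ h y) := by
  rw [modFun_congr hρ subset_union_left hF, modFun_congr hσ subset_union_right hF, modFun_sum,
    modFun_sum, map_sum]
  exact Finset.sum_congr rfl fun i hi => by rw [map_smul, hE i hi]

/-- The positive points of the spectra of `Δ_ρ` and `Δ_σ`. -/
def modularSpec (ρ : A) (σ : B) : Finset ℝ :=
  ((((Module.End.finite_spectrum (modularOp ρ)).union
    (Module.End.finite_spectrum (modularOp σ))).preimage
      Complex.ofReal_injective.injOn).toFinset).filter (0 < ·)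

theorem mem_modularSpec {ρ : A} {σ : B} {t : ℝ} : t ∈ modularSpec ρ σ ↔
    (t : ℂ) ∈ spectrum ℂ (modularOp ρ) ∪ spectrum ℂ (modularOp σ) ∧ 0 < t := by
  simp [modularSpec]

theorem card_modularSpec_le (ρ : A) (σ : B) :
    ((modularSpec ρ σ).card : ℕ∞)
      ≤ (spectrum ℂ (modularOp ρ) ∪ spectrum ℂ (modularOp σ)).encard := by
  rw [← Set.encard_coe_eq_coe_finsetCard, ← Complex.ofReal_injective.encard_image]
  refine Set.encard_le_encard ?_
  rintro _ ⟨t, ht, rfl⟩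
  exact (mem_modularSpec.1 ht).1

theorem modFun_eq_of_resolv {ρ : A} {σ : B} (hρ : PosSpec ρ) (hσ : PosSpec σ)
    (Φ : B →ₗ[ℂ] A) (x : A) (y : B) (S : Set ℝ) (hS : ∀ s ∈ S, 0 ≤ s)
    (hcard : (spectrum ℂ (modularOp ρ) ∪ spectrum ℂ (modularOp σ)).encard ≤ S.encard)
    (hE : ∀ s ∈ S, modFun ρ (fun t => (resolv s 1 t : ℂ)) x
      = Φ (modFun σ (fun t => (resolv s 1 t : ℂ)) y)) (h : ℝ → ℂ) :
    modFun ρ h x = Φ (modFun σ h y) := by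
  -- `S` may be infinite; a finite subset with as many points as the modular spectra suffices.
  obtain ⟨S', hS', hc⟩ := Set.exists_subset_encard_eq ((card_modularSpec_le ρ σ).trans hcard)
  have hfin : S'.Finite := Set.finite_of_encard_eq_coe hc
  lift S' to Finset ℝ using hfin
  rw [Set.encard_coe_eq_coe_finsetCard] at hc
  obtain ⟨c, hc'⟩ := exists_resolv_combination (modularSpec ρ σ) S'
    (fun t ht => (mem_modularSpec.1 ht).2) (fun s hs => hS s (hS' hs))
    (by exact_mod_cast hc.ge) h
  exact modFun_eq_of_combination hρ hσ Φ x y S' c (fun s t => (resolv s 1 t : ℂ)) h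
    (fun t ht ht' => hc' t (mem_modularSpec.2 ⟨ht', ht⟩)) (fun s hs => hE s (hS' hs))

theorem modFun_eq_of_imaginary_power {ρ : A} {σ : B} (hρ : PosSpec ρ) (hσ : PosSpec σ)
    (Φ : B →ₗ[ℂ] A) (x : A) (y : B)
    (hE : ∀ u : ℝ, modFun ρ (fun t => (t : ℂ) ^ (Complex.I * (u : ℂ))) x
      = Φ (modFun σ (fun t => (t : ℂ) ^ (Complex.I * (u : ℂ))) y)) (h : ℝ → ℂ) :
    modFun ρ h x = Φ (modFun σ h y) := by
  obtain ⟨n, c, u, hc⟩ := exists_imaginary_power_combination (modularSpec ρ σ)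
    (fun t ht => (mem_modularSpec.1 ht).2) h
  exact modFun_eq_of_combination hρ hσ Φ x y (Finset.range n) c
    (fun k t => (t : ℂ) ^ (Complex.I * (u k : ℂ))) h
    (fun t ht ht' => hc t (mem_modularSpec.2 ⟨ht', ht⟩)) (fun k _ => hE _)

end Interpolation

/-! ### From equality of metrics to the support of the measure -/

section RepresentingMeasure

variable {A : StarSubalgebra ℂ (H →L[ℂ] H)} {B : StarSubalgebra ℂ (K →L[ℂ] K)}

theorem ae_nonneg_of_measure_Iio {ν : Measure ℝ} (hν : ν (Iio 0) = 0) : ∀ᵐ s ∂ν, 0 ≤ s := by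
  rw [ae_iff]
  simpa [Iio_def] using hν

theorem integrable_inv_add {ν : Measure ℝ} (hν : ν (Iio 0) = 0)
    (h1 : Integrable (fun s : ℝ => (1 + s ^ 2)⁻¹) ν)
    (h2 : Integrable (fun s : ℝ => s * (1 + s ^ 2)⁻¹) ν) {t : ℝ} (ht : 0 < t) :
    Integrable (fun s : ℝ => (s + t)⁻¹) ν := by
  -- The dominating function is `(1 + t⁻¹)(1 + s)/(1 + s²)`.
  refine ((h1.add h2).const_mul (1 + t⁻¹)).mono' (by fun_prop) ?_
  filter_upwards [ae_nonneg_of_measure_Iio hν] with s hs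
  rw [Real.norm_of_nonneg (by positivity)]
  have e : (1 + t⁻¹) * (((fun s : ℝ => (1 + s ^ 2)⁻¹) + (fun s : ℝ => s * (1 + s ^ 2)⁻¹) : ℝ → ℝ) s)
      = (1 + t⁻¹) * (1 + s) / (1 + s ^ 2) := by
    simp only [Pi.add_apply]
    ring
  rw [e, le_div_iff₀ (by positivity), inv_mul_le_iff₀ (by positivity)]
  have h3 : (s + t) * (1 + t⁻¹) = s + 1 + t + s * t⁻¹ := by
    field_simp
    ring
  rw [← mul_assoc, h3]
  have : 0 ≤ s * t⁻¹ := by positivity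
  nlinarith [mul_nonneg hs this, mul_nonneg hs ht.le]

theorem integrable_quad_resolv {ρ : A} (h : PosSpec ρ) {ν : Measure ℝ} (hν : ν (Iio 0) = 0)
    (h1 : Integrable (fun s : ℝ => (1 + s ^ 2)⁻¹) ν)
    (h2 : Integrable (fun s : ℝ => s * (1 + s ^ 2)⁻¹) ν) (x : A) :
    Integrable (fun s => quad ρ (resolv s 1) x) ν := by
  simp only [quad_eq_sum, resolv, one_mul]
  refine integrable_finsetSum _ fun z hz => integrable_finsetSum _ fun w hw => ?_
  exact (integrable_inv_add hν h1 h2 (h.div_pos hz hw).1).mul_const _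

theorem quad_eq_integral {ρ : A} (h : PosSpec ρ) {f : ℝ → ℝ} {ν : Measure ℝ}
    (hν : ν (Iio 0) = 0)
    (h1 : Integrable (fun s : ℝ => (1 + s ^ 2)⁻¹) ν)
    (h2 : Integrable (fun s : ℝ => s * (1 + s ^ 2)⁻¹) ν) {c : ℝ}
    (hc : ∀ t : ℝ, 0 < t → (f t)⁻¹ = c + ∫ s, (s + t)⁻¹ ∂ν) (x : A) :
    quad ρ (fun t => (f t)⁻¹) x
      = c * quad ρ (resolv 1 0) x + ∫ s, quad ρ (resolv s 1) x ∂ν := by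
  simp only [quad_eq_sum, resolv, one_mul, zero_mul, add_zero, inv_one]
  have hi : ∀ z ∈ spec ρ, ∀ w ∈ spec ρ,
      Integrable (fun s : ℝ => (s + (z / w).re)⁻¹ * coeff ρ x z w) ν := fun z hz w hw =>
    (integrable_inv_add hν h1 h2 (h.div_pos hz hw).1).mul_const _
  rw [integral_finsetSum _ fun z hz => integrable_finsetSum _ fun w hw => hi z hz w hw,
    Finset.mul_sum, ← Finset.sum_add_distrib]
  refine Finset.sum_congr rfl fun z hz => ?_
  rw [integral_finsetSum _ fun w hw => hi z hz w hw, Finset.mul_sum, ← Finset.sum_add_distrib]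
  refine Finset.sum_congr rfl fun w hw => ?_
  rw [hc _ (h.div_pos hz hw).1, integral_mul_const, add_mul]

theorem continuousOn_quad_resolv {ρ : A} (h : PosSpec ρ) (x : A) :
    ContinuousOn (fun s => quad ρ (resolv s 1) x) (Ici 0) := by
  simp only [quad_eq_sum, resolv, one_mul]
  refine continuousOn_finsetSum _ fun z hz => continuousOn_finsetSum _ fun w hw => ?_
  refine ContinuousOn.mul (ContinuousOn.inv₀ (by fun_prop) fun s hs => ?_) continuousOn_const
  have := (h.div_pos hz hw).1
  have hs' : (0 : ℝ) ≤ s := hs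
  positivity

theorem re_monotoneMetric {ρ : A} (h : PosSpec ρ) {f : ℝ → ℝ} (hf : ∀ t, 0 < t → 0 < f t)
    {x : A} (hx : star x = x) :
    (monotoneMetric f ρ x x).re = quad ρ (fun t => (f t)⁻¹) x := by
  rw [monotoneMetric_eq h hf, quad, hx, Tr_mul_comm]

theorem modFun_eq_of_monotoneMetric_eq {ρ : A} (h : PosSpec ρ) {T : A →ₗ[ℂ] B}
    (hT : IsUnitalSchwarz (hsAdjoint T)) (hσ : PosSpec (T ρ)) {x : A} (hx : star x = x)
    {f : ℝ → ℝ} (hf : ∀ t, 0 < t → 0 < f t) {ν : Measure ℝ} (hν : IsRepresentingMeasure f ν)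
    (heq : monotoneMetric f ρ x x = monotoneMetric f (T ρ) (T x) (T x)) :
    ∀ s ∈ ν.support, 0 ≤ s ∧ modFun ρ (fun t => (resolv s 1 t : ℂ)) x
      = hsAdjoint T (modFun (T ρ) (fun t => (resolv s 1 t : ℂ)) (T x)) := by
  obtain ⟨h0, h1, h2, c, hc0, hc⟩ := hν
  set d : ℝ → ℝ := fun s => quad ρ (resolv s 1) x - quad (T ρ) (resolv s 1) (T x) with hd
  have hTx : star (T x) = T x := by rw [← map_star_of_hsAdjoint hT, hx]
  have e1 : quad ρ (fun t => (f t)⁻¹) x = quad (T ρ) (fun t => (f t)⁻¹) (T x) := by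
    rw [← re_monotoneMetric h hf hx, ← re_monotoneMetric hσ hf hTx, heq]
  rw [quad_eq_integral h h0 h1 h2 hc, quad_eq_integral hσ h0 h1 h2 hc] at e1
  have i1 := integrable_quad_resolv h h0 h1 h2 x
  have i2 := integrable_quad_resolv hσ h0 h1 h2 (T x)
  have hc1 : c * quad (T ρ) (resolv 1 0) (T x) ≤ c * quad ρ (resolv 1 0) x :=
    mul_le_mul_of_nonneg_left
      (quad_resolv_gap h zero_le_one le_rfl (by norm_num) hT hσ x).1 hc0
  have hgap : ∀ s, 0 ≤ s → 0 ≤ d s := fun s hs =>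
    sub_nonneg.2 (quad_resolv_gap h hs zero_le_one (by positivity) hT hσ x).1
  have hd0 : 0 ≤ᵐ[ν] d := by
    filter_upwards [ae_nonneg_of_measure_Iio h0] with s hs using hgap s hs
  have hint : ∫ s, d s ∂ν = 0 := by
    apply le_antisymm _ (integral_nonneg_of_ae hd0)
    rw [hd, integral_sub i1 i2]
    linarith
  have hae := (integral_eq_zero_iff_of_nonneg_ae hd0 (i1.sub i2)).1 hint
  -- The gap is continuous on `[0,∞)`, so its zero set there is closed and, having full measure,
  -- contains the support.
  have hclosed : IsClosed (Ici 0 ∩ d ⁻¹' {0}) :=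
    ((continuousOn_quad_resolv h x).sub
      (continuousOn_quad_resolv hσ (T x))).preimage_isClosed_of_isClosed isClosed_Ici
        isClosed_singleton
  have hsub := Measure.support_subset_of_isClosed (μ := ν) hclosed (by
    filter_upwards [ae_nonneg_of_measure_Iio h0, hae] with s hs hs' using ⟨hs, hs'⟩)
  intro s hs
  obtain ⟨hs0, hs1⟩ := hsub hs
  exact ⟨hs0, (quad_resolv_gap h hs0 zero_le_one (add_pos_of_nonneg_of_pos hs0 one_pos) hT hσ
    x).2 (sub_eq_zero.1 hs1).le⟩

end RepresentingMeasure

/-! ### The square root as a metric function -/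

section SquareRoot

theorem isMetricFunction_sqrt : IsMetricFunction Real.sqrt := by
  refine ⟨⟨fun t ht => Real.sqrt_pos.2 ht, fun n X Y hX _ hXY => ?_⟩, fun t ht => ?_⟩
  · have hY : 0 ≤ Y := hX.trans hXY
    have h1 := CFC.sqrt_le_sqrt X Y hXY
    rw [CFC.sqrt_eq_real_sqrt X hX, CFC.sqrt_eq_real_sqrt Y hY, cfcₙ_eq_cfc, cfcₙ_eq_cfc] at h1
    exact h1
  · rw [Real.sqrt_inv]
    have := Real.sqrt_pos.2 ht
    field_simp
    exact Real.sq_sqrt ht.le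

/-- The measure `s^{-1/2} ds / π` on `[0,∞)`, as the image of a multiple of Lebesgue measure under
squaring; it represents `t ↦ t^{-1/2}`. -/
def sqrtMeasure : Measure ℝ :=
  ENNReal.ofReal Real.pi⁻¹ • (volume : Measure ℝ).map (fun u => u ^ 2)

theorem measurable_sq : Measurable fun u : ℝ => u ^ 2 := by fun_prop

theorem integrable_sqrtMeasure {g : ℝ → ℝ} (hg : Measurable g)
    (h : Integrable fun u : ℝ => g (u ^ 2)) : Integrable g sqrtMeasure := by
  refine Integrable.smul_measure ?_ ENNReal.ofReal_ne_top
  exact (integrable_map_measure hg.aestronglyMeasurable measurable_sq.aemeasurable).2 h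

/-- Pulled back along `s = u²`, the integral becomes `π⁻¹ ∫ (u² + t)⁻¹ du` over all of `ℝ`, which
rescales to the arctangent integral and equals `t^{-1/2}`. Here `c = 0`. -/
theorem isRepresentingMeasure_sqrt : IsRepresentingMeasure Real.sqrt sqrtMeasure := by
  refine ⟨?_, ?_, ?_, 0, le_rfl, fun t ht => ?_⟩
  · rw [sqrtMeasure, Measure.smul_apply, Measure.map_apply measurable_sq measurableSet_Iio]
    have : (fun u : ℝ => u ^ 2) ⁻¹' Iio 0 = ∅ := by
      ext u
      simp [sq_nonneg u]
    rw [this]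
    simp
  · refine integrable_sqrtMeasure (by fun_prop) ?_
    refine (integrable_inv_one_add_sq.const_mul 2).mono' (by fun_prop) (ae_of_all _ fun u => ?_)
    rw [Real.norm_of_nonneg (by positivity), ← div_eq_mul_inv, le_div_iff₀ (by positivity),
      inv_mul_le_iff₀ (by positivity)]
    nlinarith [sq_nonneg (u ^ 2 - 1), sq_nonneg (u ^ 2)]
  · refine integrable_sqrtMeasure (by fun_prop) ?_
    refine (integrable_inv_one_add_sq.const_mul 2).mono' (by fun_prop) (ae_of_all _ fun u => ?_)
    rw [Real.norm_of_nonneg (by positivity), ← div_eq_mul_inv, ← div_eq_mul_inv,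
      div_le_div_iff₀ (by positivity) (by positivity)]
    nlinarith [sq_nonneg (u ^ 2 - 1), sq_nonneg (u ^ 2), sq_nonneg u]
  · have hs := Real.sqrt_pos.2 ht
    have e : ∀ u : ℝ, (u ^ 2 + t)⁻¹ = t⁻¹ * (1 + ((√t)⁻¹ * u) ^ 2)⁻¹ := by
      intro u
      rw [mul_pow, inv_pow, Real.sq_sqrt ht.le, ← mul_inv]
      congr 1
      field_simp
      ring
    rw [sqrtMeasure, integral_smul_measure,
      integral_map measurable_sq.aemeasurable (by fun_prop)]
    simp only [e]
    rw [integral_const_mul, Measure.integral_comp_mul_left (fun u : ℝ => (1 + u ^ 2)⁻¹),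
      integral_univ_inv_one_add_sq, ENNReal.toReal_ofReal (by positivity), inv_inv,
      abs_of_pos hs, smul_eq_mul, smul_eq_mul, zero_add]
    have hpi := Real.pi_ne_zero
    field_simp
    exact (Real.sq_sqrt ht.le).symm

theorem encard_support_sqrtMeasure : sqrtMeasure.support.encard = ⊤ := by
  have h : Ici (0 : ℝ) ⊆ sqrtMeasure.support := by
    intro s hs
    rw [Measure.mem_support_iff_forall]
    intro U hU
    obtain ⟨V, hVU, hV, hsV⟩ := mem_nhds_iff.1 hU
    refine lt_of_lt_of_le ?_ (measure_mono hVU)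
    rw [sqrtMeasure, Measure.smul_apply, Measure.map_apply measurable_sq hV.measurableSet,
      smul_eq_mul]
    refine ENNReal.mul_pos ?_ ?_
    · simpa using Real.pi_pos
    · refine (IsOpen.measure_pos volume (hV.preimage (by fun_prop)) ⟨√s, ?_⟩).ne'
      simpa [Real.sq_sqrt (show (0 : ℝ) ≤ s from hs)] using hsV
  rw [Set.encard_eq_top_iff]
  exact (Set.Ici_infinite 0).mono h

end SquareRoot

/-! ### Reversibility and the Petz dual -/

section Reversibility

variable {A : StarSubalgebra ℂ (H →L[ℂ] H)} {B : StarSubalgebra ℂ (K →L[ℂ] K)}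

theorem PosSpec.exists_nonneg_add_smul {ρ : A} (h : PosSpec ρ) {x : A} (hx : star x = x) :
    ∃ u : ℝ, 0 < u ∧ 0 ≤ ((ρ + (u : ℂ) • x : A) : H →L[ℂ] H) := by
  obtain ⟨r, s, hr, hs, hrr, hsr⟩ := h.exists_sqrt
  have hrs : r * s = 1 := by
    rw [← hr, ← hs, ← star_mul, hsr, star_one]
  set y : A := s * x * s with hy
  have hys : star y = y := by rw [hy, star_mul, star_mul, hs, hx, mul_assoc]
  -- With `y = ρ^{-1/2} x ρ^{-1/2}`, this choice gives `‖u y‖ ≤ 1`, so `1 + u y ≥ 0`; conjugating by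
  -- `ρ^{1/2}` gives `ρ + u x ≥ 0`.
  set u : ℝ := (1 + ‖(y : H →L[ℂ] H)‖)⁻¹ with hu
  have hu0 : 0 < u := by positivity
  refine ⟨u, hu0, ?_⟩
  have h1 : 0 ≤ ((1 + (u : ℂ) • y : A) : H →L[ℂ] H) := by
    have hsa : IsSelfAdjoint (u • (y : H →L[ℂ] H)) := by
      rw [IsSelfAdjoint, star_smul, star_trivial]
      exact congrArg (u • ·) (congrArg Subtype.val hys)
    have h2 := hsa.neg_algebraMap_norm_le_self
    have h3 : ‖u • (y : H →L[ℂ] H)‖ ≤ 1 := by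
      rw [norm_smul, Real.norm_of_nonneg hu0.le, hu, inv_mul_le_one₀ (by positivity)]
      linarith
    have h4 : (algebraMap ℝ (H →L[ℂ] H)) ‖u • (y : H →L[ℂ] H)‖ ≤ algebraMap ℝ (H →L[ℂ] H) 1 :=
      algebraMap_mono _ h3
    rw [map_one] at h4
    have h5 : -1 ≤ u • (y : H →L[ℂ] H) := (neg_le_neg h4).trans h2
    have h6 := neg_le_iff_add_nonneg'.1 h5
    exact h6
  have h7 := star_right_conjugate_nonneg h1 (r : H →L[ℂ] H)
  have e : ρ + (u : ℂ) • x = r * (1 + (u : ℂ) • y) * star r := by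
    have e1 : r * y * r = x := by
      rw [hy, mul_assoc, mul_assoc, hsr, mul_one, ← mul_assoc, hrs, one_mul]
    rw [hr, mul_add, add_mul, mul_one, hrr, mul_smul_comm, smul_mul_assoc, e1]
  rw [e]
  exact h7

/-- The segment contains a second state `ρ + u x` with `u ≠ 0`, so linearity recovers the action on
`x`. -/
theorem isReversible_stateSegment {ρ x : A} {T : A →ₗ[ℂ] B} (hρ : IsDensity ρ) (h : PosSpec ρ)
    (hx : star x = x) (hxt : Tr x = 0) (hrev : IsReversible T (stateSegment ρ x)) :
    ∃ S : B →ₗ[ℂ] A, IsUnitalSchwarz (hsAdjoint S) ∧ S (T ρ) = ρ ∧ S (T x) = x := by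
  obtain ⟨S, hS, hST⟩ := hrev
  have h0 : S (T ρ) = ρ := hST ρ ⟨0, by simpa [stateInterval] using hρ, by simp⟩
  refine ⟨S, hS, h0, ?_⟩
  obtain ⟨u, hu, hpos⟩ := h.exists_nonneg_add_smul hx
  have h1 := hST (ρ + (u : ℂ) • x) ⟨u, ⟨hpos, by rw [map_add, map_smul, hxt, hρ.2]; simp⟩, rfl⟩
  rw [map_add, map_add, h0, map_smul, map_smul] at h1
  have hu' : (u : ℂ) ≠ 0 := by exact_mod_cast hu.ne'
  exact smul_right_injective A hu' (add_left_cancel h1)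

/-- Monotonicity for `S` at `T(ρ)` is the reverse of monotonicity for `T` at `ρ`, so the gap is
zero. -/
theorem modFun_resolv_eq_of_reverse {ρ x : A} {T : A →ₗ[ℂ] B} (h : PosSpec ρ)
    (hT : IsUnitalSchwarz (hsAdjoint T)) (hσ : PosSpec (T ρ)) {S : B →ₗ[ℂ] A}
    (hS : IsUnitalSchwarz (hsAdjoint S)) (hSρ : S (T ρ) = ρ) (hSx : S (T x) = x) {s : ℝ}
    (hs : 0 ≤ s) :
    modFun ρ (fun t => (resolv s 1 t : ℂ)) x
      = hsAdjoint T (modFun (T ρ) (fun t => (resolv s 1 t : ℂ)) (T x)) := by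
  have hpos : 0 < s + 1 := by positivity
  have h1 := (quad_resolv_gap hσ hs zero_le_one hpos hS (hSρ.symm ▸ h) (T x)).1
  rw [hSρ, hSx] at h1
  exact (quad_resolv_gap h hs zero_le_one hpos hT hσ x).2 h1

/-- The Petz dual of `T`. -/
def petzDual (T : A →ₗ[ℂ] B) (ρ : A) : B →ₗ[ℂ] A :=
  LinearMap.mulLeftRight ℂ (cpower ρ (1 / 2), cpower ρ (1 / 2)) ∘ₗ hsAdjoint T ∘ₗ
    LinearMap.mulLeftRight ℂ (cpower (T ρ) (-1 / 2), cpower (T ρ) (-1 / 2))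

theorem petzDual_apply (T : A →ₗ[ℂ] B) (ρ : A) (b : B) :
    petzDual T ρ b = cpower ρ (1 / 2) *
      hsAdjoint T (cpower (T ρ) (-1 / 2) * b * cpower (T ρ) (-1 / 2)) * cpower ρ (1 / 2) := rfl

theorem dualMap_apply (T : A →ₗ[ℂ] B) (ρ : A) (a : A) :
    dualMap T ρ a = cpower (T ρ) (-1 / 2) *
      T (cpower ρ (1 / 2) * a * cpower ρ (1 / 2)) * cpower (T ρ) (-1 / 2) := rfl

theorem star_cpower_half {ρ : A} (h : PosSpec ρ) :
    star (cpower ρ (1 / 2)) = cpower ρ (1 / 2) := by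
  have := h.star_cpower (1 / 2)
  push_cast at this
  exact this

theorem star_cpower_neg_half {ρ : A} (h : PosSpec ρ) :
    star (cpower ρ (-1 / 2)) = cpower ρ (-1 / 2) := by
  have := h.star_cpower (-1 / 2)
  push_cast at this
  exact this

/-- Cyclicity of the trace. The Schwarz hypothesis on `T_ρ` thereby makes the Petz dual an
admissible recovery map. -/
theorem hsAdjoint_petzDual {ρ : A} {T : A →ₗ[ℂ] B} (h : PosSpec ρ)
    (hT : IsUnitalSchwarz (hsAdjoint T)) (hσ : PosSpec (T ρ)) :
    hsAdjoint (petzDual T ρ) = dualMap T ρ := by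
  refine hsAdjoint_eq_of_Tr fun b a => ?_
  rw [petzDual_apply, dualMap_apply]
  set r := cpower ρ (1 / 2) with hr
  set q := cpower (T ρ) (-1 / 2) with hq
  have er : star r = r := star_cpower_half h
  have eq : star q = q := star_cpower_neg_half hσ
  rw [star_mul, star_mul, eq, ← map_star_of_hsAdjoint hT, star_mul, star_mul, er]
  have e1 : Tr (q * (T (r * (star a * r)) * q) * b)
      = Tr ((q * b * q) * T (r * (star a * r))) := by
    rw [mul_assoc q, Tr_mul_comm q, Tr_mul_comm _ (T _)]
    simp only [mul_assoc]
  rw [e1, ← Tr_hsAdjoint_mul hT, Tr_mul_comm (star a)]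
  simp only [← mul_assoc]
  rw [Tr_mul_comm _ r]
  simp only [← mul_assoc]

theorem PosSpec.sandwich_half {ρ : A} (h : PosSpec ρ) (a : A) :
    cpower ρ (1 / 2) * (cpower ρ (-1 / 2) * a * cpower ρ (-1 / 2)) * cpower ρ (1 / 2) = a := by
  have h1 : cpower ρ (1 / 2) * cpower ρ (-1 / 2) = 1 := by
    rw [h.cpower_mul]; norm_num [h.cpower_zero]
  have h2 : cpower ρ (-1 / 2) * cpower ρ (1 / 2) = 1 := by
    rw [h.cpower_mul]; norm_num [h.cpower_zero]
  rw [mul_assoc, mul_assoc _ (cpower ρ (-1 / 2)), h2, mul_one, ← mul_assoc, h1, one_mul]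

/-- The Petz dual sends `T(ρ)` to `ρ` because `T*` is unital, and `T(x)` to `x` by the square-root
identity; linearity covers the segment. -/
theorem isReversible_of_half {ρ x : A} {T : A →ₗ[ℂ] B} (h : PosSpec ρ)
    (hT : IsUnitalSchwarz (hsAdjoint T)) (hTd : IsUnitalSchwarz (dualMap T ρ))
    (hσ : PosSpec (T ρ))
    (hx : cpower ρ (-1 / 2) * x * cpower ρ (-1 / 2)
      = hsAdjoint T (cpower (T ρ) (-1 / 2) * T x * cpower (T ρ) (-1 / 2))) :
    IsReversible T (stateSegment ρ x) := by
  refine ⟨petzDual T ρ, by rwa [hsAdjoint_petzDual h hT hσ], ?_⟩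
  have h1 : petzDual T ρ (T ρ) = ρ := by
    have e : cpower (T ρ) (-1 / 2) * T ρ * cpower (T ρ) (-1 / 2) = 1 := by
      nth_rewrite 2 [← hσ.cpower_one]
      rw [hσ.cpower_mul, hσ.cpower_mul]
      norm_num [hσ.cpower_zero]
    rw [petzDual_apply, e, hT.1, mul_one, h.cpower_mul]
    norm_num [h.cpower_one]
  have h2 : petzDual T ρ (T x) = x := by
    rw [petzDual_apply, ← hx, h.sandwich_half]
  rintro _ ⟨u, -, rfl⟩
  simp only [map_add, map_smul, h1, h2]

end Reversibility

end QRev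

end

theorem proposition7 {H K : Type*}
    [NormedAddCommGroup H] [InnerProductSpace ℂ H] [CompleteSpace H] [FiniteDimensional ℂ H]
    [NormedAddCommGroup K] [InnerProductSpace ℂ K] [CompleteSpace K] [FiniteDimensional ℂ K]
    (A : StarSubalgebra ℂ (H →L[ℂ] H)) (B : StarSubalgebra ℂ (K →L[ℂ] K))
    (T : A →ₗ[ℂ] B) (ρ x : A)
    (hρ : QRev.IsDensity ρ) (hρ_inv : IsUnit ρ) (hTρ_inv : IsUnit (T ρ))
    (hT : QRev.IsUnitalSchwarz (QRev.hsAdjoint T))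
    (hTdual : QRev.IsUnitalSchwarz (QRev.dualMap T ρ))
    (hx : IsSelfAdjoint x) (hx_tr : QRev.Tr x = 0) :
    List.TFAE [
      -- preservation of one monotone metric with enough support points
      ∃ (f : ℝ → ℝ) (ν : MeasureTheory.Measure ℝ),
        QRev.IsMetricFunction f ∧ QRev.IsRepresentingMeasure f ν ∧
        (spectrum ℂ (QRev.modularOp ρ) ∪ spectrum ℂ (QRev.modularOp (T ρ))).encard
          ≤ ν.support.encard ∧
        QRev.monotoneMetric f ρ x x = QRev.monotoneMetric f (T ρ) (T x) (T x),
      -- the identity with unitary powers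
      ∀ t : ℝ,
        QRev.cpower ρ (Complex.I * t) * x * QRev.cpower ρ (-(Complex.I * t) - 1)
          = QRev.hsAdjoint T
              (QRev.cpower (T ρ) (Complex.I * t) * T x *
                QRev.cpower (T ρ) (-(Complex.I * t) - 1)),
      -- the identity with square roots
      QRev.cpower ρ (-1 / 2) * x * QRev.cpower ρ (-1 / 2)
        = QRev.hsAdjoint T
            (QRev.cpower (T ρ) (-1 / 2) * T x * QRev.cpower (T ρ) (-1 / 2)),
      -- reversibility for the segment of states
      QRev.IsReversible T (QRev.stateSegment ρ x),
      -- preservation of all monotone metrics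
      ∀ f : ℝ → ℝ, QRev.IsMetricFunction f →
        QRev.monotoneMetric f ρ x x = QRev.monotoneMetric f (T ρ) (T x) (T x)] := by
  have h : QRev.PosSpec ρ := QRev.posSpec_of_isDensity hρ hρ_inv
  have hσ : QRev.PosSpec (T ρ) := QRev.posSpec_map h hT hTρ_inv
  have hTx : star (T x) = T x := by rw [← QRev.map_star_of_hsAdjoint hT, hx.star_eq]
  have all2 (hP : ∀ g : ℝ → ℂ,
      QRev.modFun ρ g x = QRev.hsAdjoint T (QRev.modFun (T ρ) g (T x))) (z : ℂ) :
      QRev.cpower ρ z * x * QRev.cpower ρ (-z - 1)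
          = QRev.hsAdjoint T
              (QRev.cpower (T ρ) z * T x * QRev.cpower (T ρ) (-z - 1)) := by
    rw [QRev.cpower_mul_mul_cpower h, QRev.cpower_mul_mul_cpower hσ]
    exact hP _
  have all3 (hP : ∀ g : ℝ → ℂ,
      QRev.modFun ρ g x = QRev.hsAdjoint T (QRev.modFun (T ρ) g (T x))) :
      QRev.cpower ρ (-1 / 2) * x * QRev.cpower ρ (-1 / 2)
        = QRev.hsAdjoint T
            (QRev.cpower (T ρ) (-1 / 2) * T x * QRev.cpower (T ρ) (-1 / 2)) := by
    have := all2 hP (-1 / 2)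
    rwa [show (-(-1 / 2) - 1 : ℂ) = -1 / 2 by norm_num] at this
  tfae_have 1 → 2 := by
    rintro ⟨f, ν, hf, hν, hcard, heq⟩ t
    have hE := QRev.modFun_eq_of_monotoneMetric_eq h hT hσ hx.star_eq hf.1.1 hν heq
    exact all2 (QRev.modFun_eq_of_resolv h hσ _ _ _ _ (fun s hs => (hE s hs).1) hcard
      fun s hs => (hE s hs).2) _
  tfae_have 2 → 3 := by
    intro h2
    refine all3 (QRev.modFun_eq_of_imaginary_power h hσ _ _ _ fun u => ?_)
    rw [← QRev.cpower_mul_mul_cpower h, ← QRev.cpower_mul_mul_cpower hσ]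
    exact h2 u
  tfae_have 3 → 4 := QRev.isReversible_of_half h hT hTdual hσ
  tfae_have 4 → 5 := by
    intro hrev f hf
    obtain ⟨S, hS, hSρ, hSx⟩ := QRev.isReversible_stateSegment hρ h hx.star_eq hx_tr hrev
    -- All `s ≥ 0` are available here, so the cardinality bound is free.
    have hP := QRev.modFun_eq_of_resolv h hσ (QRev.hsAdjoint T) x (T x) (Set.Ici 0)
      (fun s hs => hs) (by rw [(Set.Ici_infinite (0 : ℝ)).encard_eq]; exact le_top)
      fun s hs => QRev.modFun_resolv_eq_of_reverse h hT hσ hS hSρ hSx hs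
    rw [QRev.monotoneMetric_eq h hf.1.1, QRev.monotoneMetric_eq hσ hf.1.1, hP,
      QRev.Tr_hsAdjoint_mul hT]
  tfae_have 5 → 1 := fun h5 =>
    ⟨Real.sqrt, QRev.sqrtMeasure, QRev.isMetricFunction_sqrt, QRev.isRepresentingMeasure_sqrt,
      by rw [QRev.encard_support_sqrtMeasure]; exact le_top, h5 _ QRev.isMetricFunction_sqrt⟩
  tfae_finish
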